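/- Write $\mathcal P[0,1]$ for the space of Borel probability measures on $[0,1]$. A *qmm-space* $(X,\mu,d^*)$ is a standard Borel space $X$ with a Borel probability measure $\mu$ and a Borel map $d^*:X\times X\to\mathcal P[0,1]$ such that $d^*(x,x)=\delta_0$, $d^*(x,y)=d^*(y,x)$ and, for $\mu^3$-almost every triple $(a,b,c)$ of pairwise different points, independent random lengths with laws $d^*(a,b),d^*(b,c),d^*(a,c)$ satisfy the triangle inequalities almost surely. *Ultralimits.* Let $\omega$ be a nonprincipal ultrafilter on the index set $\{1,2,\dots\}$ and let $(X_n,\mu_n)$ be probability spaces. The ultralimit $\mathbf X$ is the set of classes $[(x_n)]$ of sequences $x_n\in X_n$, two sequences being identified if they agree on a set of indices in $\omega$. The ultralimit $\mathbf A\subseteq\mathbf X$ of measurable sets $A_n\subseteq X_n$ is the set of all $[(x_n)]$ with $\{n: x_n\in A_n\}\in\omega$; put $\mu_{\mathbf X}(\mathbf A)=\lim_\omega\mu_n(A_n)$. A set is null if for every $\varepsilon>0$ it is contained in such an $\mathbf A$ with $\mu_{\mathbf X}(\mathbf A)<\varepsilon$. The $\sigma$-algebra $\mathcal M$ consists of the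 sets $M$ for which $M\triangle\mathbf A$ is null for some such $\mathbf A$, and $\mu_{\mathbf X}(M)=\mu_{\mathbf X}(\mathbf A)$. The same construction for the spaces $(X_n\times X_n,\mu_n\times\mu_n)$ gives a $\sigma$-algebra $\mathcal M_2\supseteq\mathcal M\times\mathcal M$ and a probability measure $\mu_{\mathbf X}^2$ on $\mathbf X\times\mathbf X$. Functions $d_n:X_n\times X_n\to[0,1]$ have the ultralimit $\mathbf d([(x_n)],[(y_n)])=\lim_\omega d_n(x_n,y_n)$. A version of $\mathbf d^*_{\mathbf X}=E(\delta_{\mathbf d}\mid\mathcal M\times\mathcal M)$ is a map $D:\mathbf X\times\mathbf X\to\mathcal P[0,1]$ such that for every $g\in C[0,1]$ the function $p\mapsto\int g\,dD(p)$ is $\mathcal M\times\mathcal M$-measurable and $\int_B\int g\,dD(p)\,d\mu_{\mathbf X}^2(p)=\int_B g(\mathbf d(p))\,d\mu^2_{\mathbf X}(p)$ for all $B\in\mathcal M\times\mathcal M$. **Theorem.** Let $(X,\mu,d^*)$ be a qmm-space whose underlying Borel space is that of a compact metric space $X$ (for example $X=[0,1]$; every non-empty standard Borel space is Borel isomorphic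 to a compact metric space), and let $\omega$ be a nonprincipal ultrafilter. Pick independent $\mu$-random points $x_1,x_2,\dots$ and, given these, independent numbers $d(i,j)$, $i<j$, with laws $d^*(x_i,x_j)$; put $d(j,i)=d(i,j)$ and $d(i,i)=0$. Let $X_n=\{1,\dots,n\}$ with the uniform probability measure and the distance function $d$, let $\pi_n:X_n\to X$, $\pi_n(i)=x_i$, let $\mathbf X$ be the ultralimit of the $X_n$, and let $\pi:\mathbf X\to X$, $\pi([(i_n)])=\lim_\omega\pi_n(i_n)$. Then with probability one $\pi$ is a separable realization: $\pi$ is measurable, $\pi_*(\mu_{\mathbf X})=\mu$, versions of $\mathbf d^*_{\mathbf X}$ exist, and for each of them $d^*(\pi(p),\pi(q))=\mathbf d^*_{\mathbf X}(p,q)$ for $\mu_{\mathbf X}^2$-almost every $(p,q)\in\mathbf X\times\mathbf X$. -/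

import Mathlib

open MeasureTheory ProbabilityTheory Filter Topology Set
open scoped unitInterval ENNReal

noncomputable section

namespace QMM

/-! ## Ultralimits of points, sets and functions -/

/-- A nonprincipal ultrafilter on `ℕ`. -/
class Nonprincipal (ω : Ultrafilter ℕ) : Prop where
  ne_pure : ∀ n, ω ≠ pure n

/-- The ultralimit `lim_ω y_n` of a sequence of points (in a compact Hausdorff space). -/
def ulim {Y : Type*} [TopologicalSpace Y] (ω : Ultrafilter ℕ) (y : ℕ → Y) : Y :=
  (ω.map y).lim

theorem tendsto_ulim {Y : Type*} [TopologicalSpace Y] [CompactSpace Y] (ω : Ultrafilter ℕ)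
    (y : ℕ → Y) : Tendsto y ω (𝓝 (ulim ω y)) :=
  (ω.map y).le_nhds_lim

theorem ulim_congr {Y : Type*} [TopologicalSpace Y] (ω : Ultrafilter ℕ) {y z : ℕ → Y}
    (h : ∀ᶠ n in (ω : Filter ℕ), y n = z n) : ulim ω y = ulim ω z := by
  have : ω.map y = ω.map z := by
    apply Ultrafilter.coe_injective
    rw [Ultrafilter.coe_map, Ultrafilter.coe_map]
    exact Filter.map_congr h
  rw [ulim, ulim, this]

theorem Nonprincipal.eventually_ge (ω : Ultrafilter ℕ) [h : Nonprincipal ω] (k : ℕ) :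
    ∀ᶠ n in (ω : Filter ℕ), k ≤ n := by
  have h1 : (ω : Filter ℕ) ≤ cofinite := by
    rcases ω.le_cofinite_or_eq_pure with h' | ⟨a, ha⟩
    · exact h'
    · exact absurd ha (h.ne_pure a)
  rw [Nat.cofinite_eq_atTop] at h1
  exact h1 (eventually_ge_atTop k)

section Loeb

variable {X : ℕ → Type*} [∀ n, MeasurableSpace (X n)]

/-- The set-theoretic ultralimit of the probability spaces `(X n, P n)`: sequences of points, two
sequences being identified when they agree on a set of indices that belongs to `ω`. The measures
are recorded in the type because they determine its σ-algebra. -/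
def UltraProd (ω : Ultrafilter ℕ) (_P : ∀ n, Measure (X n)) : Type _ :=
  (ω : Filter ℕ).Product X

namespace UltraProd

/-- The class `[x]` of a sequence. -/
def mk (ω : Ultrafilter ℕ) (P : ∀ n, Measure (X n)) (x : ∀ n, X n) : UltraProd ω P :=
  Quotient.mk (productSetoid (ω : Filter ℕ) X) x

variable {ω : Ultrafilter ℕ} {P : ∀ n, Measure (X n)}

/-- The ultralimit of maps `f n : X n → Y`, that is `[x] ↦ lim_ω f n (x n)`. -/
def ulimFun {Y : Type*} [TopologicalSpace Y] (f : ∀ n, X n → Y) : UltraProd ω P → Y :=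
  Quotient.lift (fun x : ∀ n, X n => ulim ω fun n => f n (x n)) fun x y h => by
    have h' : ∀ᶠ n in (ω : Filter ℕ), x n = y n := h
    exact ulim_congr ω (h'.mono fun n hn => by rw [hn])

/-- The map `[x] ↦ [f n (x n)]` between ultralimits. -/
def map {Y : ℕ → Type*} [∀ n, MeasurableSpace (Y n)] {R : ∀ n, Measure (Y n)}
    (f : ∀ n, X n → Y n) : UltraProd ω P → UltraProd ω R :=
  Quotient.lift (fun x : ∀ n, X n => mk ω R fun n => f n (x n)) fun x y h => by
    have h' : ∀ᶠ n in (ω : Filter ℕ), x n = y n := h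
    refine Quotient.sound ?_
    change ∀ᶠ n in (ω : Filter ℕ), f n (x n) = f n (y n)
    exact h'.mono fun n hn => by rw [hn]

/-- The ultralimit of the sets `A n`: `[x]` belongs to it iff `{n | x n ∈ A n} ∈ ω`. -/
def internal (ω : Ultrafilter ℕ) (P : ∀ n, Measure (X n)) (A : ∀ n, Set (X n)) :
    Set (UltraProd ω P) :=
  {q | ∃ x, mk ω P x = q ∧ ∀ᶠ n in (ω : Filter ℕ), x n ∈ A n}

/-- The finitely additive measure `lim_ω P n (A n)` of the ultralimit of the sets `A n`. -/
def content (ω : Ultrafilter ℕ) (P : ∀ n, Measure (X n)) (A : ∀ n, Set (X n)) : ℝ≥0∞ :=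
  ulim ω fun n => P n (A n)

/-- Null sets: sets covered by ultralimit sets of arbitrarily small measure. -/
def IsNull (N : Set (UltraProd ω P)) : Prop :=
  ∀ ε : ℝ≥0∞, 0 < ε → ∃ A : ∀ n, Set (X n), (∀ n, MeasurableSet (A n)) ∧
    N ⊆ internal ω P A ∧ content ω P A < ε

/-- `M` agrees with the ultralimit of the measurable sets `A n` up to a null set. -/
def Approx (A : ∀ n, Set (X n)) (M : Set (UltraProd ω P)) : Prop :=
  (∀ n, MeasurableSet (A n)) ∧ IsNull (symmDiff (internal ω P A) M)

theorem mk_surj (q : UltraProd ω P) : ∃ x, mk ω P x = q := Quotient.exists_rep q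

theorem mk_mem_internal {A : ∀ n, Set (X n)} {x : ∀ n, X n} :
    mk ω P x ∈ internal ω P A ↔ ∀ᶠ n in (ω : Filter ℕ), x n ∈ A n := by
  constructor
  · rintro ⟨y, hy, h⟩
    have : ∀ᶠ n in (ω : Filter ℕ), y n = x n := Quotient.exact hy
    filter_upwards [h, this] with n h1 h2
    rwa [← h2]
  · exact fun h => ⟨x, rfl, h⟩

theorem internal_mono {A B : ∀ n, Set (X n)} (h : ∀ᶠ n in (ω : Filter ℕ), A n ⊆ B n) :
    internal ω P A ⊆ internal ω P B := by
  rintro _ ⟨x, rfl, hx⟩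
  rw [mk_mem_internal]
  filter_upwards [h, hx] with n h1 h2 using h1 h2

theorem compl_internal (A : ∀ n, Set (X n)) :
    (internal ω P A)ᶜ = internal ω P fun n => (A n)ᶜ := by
  ext q
  obtain ⟨x, rfl⟩ := mk_surj q
  rw [mem_compl_iff, mk_mem_internal, mk_mem_internal, ← Ultrafilter.eventually_not]
  rfl

theorem internal_union (A B : ∀ n, Set (X n)) :
    (internal ω P fun n => A n ∪ B n) = internal ω P A ∪ internal ω P B := by
  ext q
  obtain ⟨x, rfl⟩ := mk_surj q
  rw [mem_union, mk_mem_internal, mk_mem_internal, mk_mem_internal, ← Ultrafilter.eventually_or]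
  rfl

theorem internal_inter (A B : ∀ n, Set (X n)) :
    (internal ω P fun n => A n ∩ B n) = internal ω P A ∩ internal ω P B := by
  ext q
  obtain ⟨x, rfl⟩ := mk_surj q
  rw [mem_inter_iff, mk_mem_internal, mk_mem_internal, mk_mem_internal, ← eventually_and]
  rfl

theorem internal_diff (A B : ∀ n, Set (X n)) :
    (internal ω P fun n => A n \ B n) = internal ω P A \ internal ω P B := by
  simp only [sdiff_eq, compl_internal]
  exact internal_inter A fun n => (B n)ᶜ

theorem internal_empty : (internal ω P fun _ => ∅) = ∅ := by
  ext q
  obtain ⟨x, rfl⟩ := mk_surj q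
  rw [mk_mem_internal]
  simp [ω.neBot.ne]

theorem eventually_subset [∀ n, Nonempty (X n)] {A B : ∀ n, Set (X n)}
    (h : internal ω P A ⊆ internal ω P B) : ∀ᶠ n in (ω : Filter ℕ), A n ⊆ B n := by
  by_contra hc
  rw [← Ultrafilter.eventually_not] at hc
  have : ∀ n, ∃ x : X n, ¬ A n ⊆ B n → x ∈ A n ∧ x ∉ B n := by
    intro n
    by_cases hn : A n ⊆ B n
    · exact ⟨Classical.arbitrary _, fun h' => absurd hn h'⟩
    · obtain ⟨x, hx⟩ := Set.not_subset.1 hn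
      exact ⟨x, fun _ => hx⟩
  choose x hx using this
  have h1 : mk ω P x ∈ internal ω P A :=
    mk_mem_internal.2 (hc.mono fun n hn => (hx n hn).1)
  have h2 := mk_mem_internal.1 (h h1)
  obtain ⟨n, hn1, hn2⟩ := (hc.and h2).exists
  exact (hx n hn1).2 hn2

theorem tendsto_content (A : ∀ n, Set (X n)) :
    Tendsto (fun n => P n (A n)) ω (𝓝 (content ω P A)) := tendsto_ulim ω _

theorem content_mono {A B : ∀ n, Set (X n)} (h : ∀ᶠ n in (ω : Filter ℕ), A n ⊆ B n) :
    content ω P A ≤ content ω P B :=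
  le_of_tendsto_of_tendsto (tendsto_content A) (tendsto_content B)
    (h.mono fun _ hn => measure_mono hn)

theorem content_empty : content ω P (fun _ => ∅) = 0 := by
  refine tendsto_nhds_unique (tendsto_content _) ?_
  simp

theorem content_union_add_inter (A : ∀ n, Set (X n)) {B : ∀ n, Set (X n)}
    (hB : ∀ n, MeasurableSet (B n)) :
    (content ω P fun n => A n ∪ B n) + (content ω P fun n => A n ∩ B n) =
      content ω P A + content ω P B := by
  refine tendsto_nhds_unique ((tendsto_content _).add (tendsto_content _)) ?_
  simp only [fun n => measure_union_add_inter (μ := P n) (A n) (hB n)]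
  exact (tendsto_content A).add (tendsto_content B)

theorem content_union_le (A B : ∀ n, Set (X n)) :
    (content ω P fun n => A n ∪ B n) ≤ content ω P A + content ω P B :=
  le_of_tendsto_of_tendsto' (tendsto_content _) ((tendsto_content A).add (tendsto_content B))
    fun _ => measure_union_le _ _

theorem content_diff_add {A B : ∀ n, Set (X n)} (hB : ∀ n, MeasurableSet (B n))
    (h : ∀ᶠ n in (ω : Filter ℕ), B n ⊆ A n) :
    (content ω P fun n => A n \ B n) + content ω P B = content ω P A := by
  refine tendsto_nhds_unique ((tendsto_content _).add (tendsto_content _)) ?_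
  refine (tendsto_content A).congr' (h.mono fun n hn => ?_)
  rw [← measure_sdiff_add_inter (μ := P n) (A n) (hB n), inter_eq_right.2 hn]

theorem content_le_one [∀ n, IsProbabilityMeasure (P n)] (A : ∀ n, Set (X n)) :
    content ω P A ≤ 1 :=
  le_of_tendsto' (tendsto_content A) fun _ => prob_le_one

theorem measurableSet_accumulate {Y : Type*} [MeasurableSpace Y] {A : ℕ → Set Y}
    (h : ∀ j, MeasurableSet (A j)) (k : ℕ) : MeasurableSet (accumulate A k) := by
  induction k with
  | zero => simpa [accumulate_zero_nat] using h 0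
  | succ k ih => rw [accumulate_succ]; exact ih.union (h _)

/-- Countable saturation with control of the measure. -/
theorem saturation [Nonprincipal ω] {B : ℕ → ∀ n, Set (X n)}
    (hB : ∀ k n, MeasurableSet (B k n)) (hmono : ∀ n, Monotone fun k => B k n)
    {a : ℝ≥0∞} (ha : a ≠ ∞) (hBa : ∀ k, content ω P (B k) ≤ a) :
    ∃ A : ∀ n, Set (X n), (∀ n, MeasurableSet (A n)) ∧
      (∀ k, ∀ᶠ n in (ω : Filter ℕ), B k n ⊆ A n) ∧ content ω P A ≤ a := by
  classical
  let S : ℕ → ℕ → Prop := fun n k => P n (B k n) ≤ a + ((k : ℝ≥0∞) + 1)⁻¹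
  have hS : ∀ k, ∀ᶠ n in (ω : Filter ℕ), S n k := by
    intro k
    have hlt : content ω P (B k) < a + ((k : ℝ≥0∞) + 1)⁻¹ :=
      lt_of_le_of_lt (hBa k) (ENNReal.lt_add_right ha (by simp))
    exact ((tendsto_content (B k)).eventually_lt_const hlt).mono fun n hn => hn.le
  let h : ℕ → ℕ := fun n => Nat.findGreatest (S n) n
  have hh : ∀ k, ∀ᶠ n in (ω : Filter ℕ), k ≤ h n := fun k => by
    filter_upwards [hS k, Nonprincipal.eventually_ge ω k] with n h1 h2
    exact Nat.le_findGreatest h2 h1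
  refine ⟨fun n => B (h n) n, fun n => hB _ n, fun k => ?_, ?_⟩
  · filter_upwards [hh k] with n hn using hmono n hn
  · have key : ∀ k : ℕ, content ω P (fun n => B (h n) n) ≤ a + ((k : ℝ≥0∞) + 1)⁻¹ := by
      intro k
      refine le_of_tendsto (tendsto_content _) ?_
      filter_upwards [hS 0, hh k] with n h0 hk
      have hs : S n (h n) := Nat.findGreatest_spec (Nat.zero_le n) h0
      refine hs.trans ?_
      gcongr
    have hlim : Tendsto (fun k : ℕ => a + ((k : ℝ≥0∞) + 1)⁻¹) atTop (𝓝 (a + 0)) := by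
      refine tendsto_const_nhds.add ?_
      have := (tendsto_add_atTop_iff_nat 1).2 ENNReal.tendsto_inv_nat_nhds_zero
      simpa using this
    rw [add_zero] at hlim
    exact ge_of_tendsto' hlim key

theorem IsNull.mono {N N' : Set (UltraProd ω P)} (h : IsNull N) (hs : N' ⊆ N) : IsNull N' :=
  fun ε hε => let ⟨A, h1, h2, h3⟩ := h ε hε; ⟨A, h1, hs.trans h2, h3⟩

theorem isNull_empty : IsNull (∅ : Set (UltraProd ω P)) :=
  fun _ hε => ⟨fun _ => ∅, fun _ => .empty, empty_subset _, by rwa [content_empty]⟩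

theorem content_accumulate_le (A : ℕ → ∀ n, Set (X n)) (k : ℕ) :
    (content ω P fun n => accumulate (fun j => A j n) k) ≤
      ∑ j ∈ Finset.range (k + 1), content ω P (A j) := by
  induction k with
  | zero => simp [accumulate_zero_nat]
  | succ k ih =>
    simp only [accumulate_succ]
    rw [Finset.sum_range_succ]
    exact (content_union_le _ _).trans (by gcongr)

theorem IsNull.iUnion [Nonprincipal ω] {N : ℕ → Set (UltraProd ω P)} (h : ∀ k, IsNull (N k)) :
    IsNull (⋃ k, N k) := by
  intro ε hε
  obtain ⟨δ, hδ0, hδ⟩ := ENNReal.exists_pos_sum_of_countable' hε.ne' ℕ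
  choose A hA hNA hAδ using fun k => h k (δ k) (hδ0 k)
  obtain ⟨C, hC, hBC, hCa⟩ := saturation (ω := ω) (P := P)
    (B := fun k n => accumulate (fun j => A j n) k)
    (fun k n => measurableSet_accumulate (fun j => hA j n) k)
    (fun n => monotone_accumulate) (a := ∑' k, δ k) (ne_top_of_lt hδ) (fun k =>
      (content_accumulate_le A k).trans
        ((Finset.sum_le_sum fun j _ => (hAδ j).le).trans (ENNReal.sum_le_tsum _)))
  refine ⟨C, hC, iUnion_subset fun k => (hNA k).trans (internal_mono ?_), hCa.trans_lt hδ⟩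
  filter_upwards [hBC k] with n hn
  exact (subset_accumulate (s := fun j => A j n)).trans hn

theorem IsNull.union [Nonprincipal ω] {N N' : Set (UltraProd ω P)} (h : IsNull N)
    (h' : IsNull N') : IsNull (N ∪ N') := by
  rw [union_eq_iUnion]
  have : ⋃ b : Bool, cond b N N' ⊆ ⋃ k : ℕ, (if k = 0 then N else N') := by
    refine iUnion_subset fun b => ?_
    cases b
    · exact subset_iUnion_of_subset 1 (by simp)
    · exact subset_iUnion_of_subset 0 (by simp)
  refine IsNull.mono (IsNull.iUnion fun k => ?_) this
  split_ifs <;> assumption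

theorem IsNull.content_eq_zero [∀ n, Nonempty (X n)] {A : ∀ n, Set (X n)}
    (h : IsNull (internal ω P A)) : content ω P A = 0 := by
  by_contra hc
  obtain ⟨B, -, h2, h3⟩ := h _ (pos_iff_ne_zero.2 hc)
  exact absurd (content_mono (P := P) (eventually_subset h2)) (not_le.2 h3)

theorem Approx.compl {A : ∀ n, Set (X n)} {M : Set (UltraProd ω P)} (h : Approx A M) :
    Approx (fun n => (A n)ᶜ) Mᶜ := by
  refine ⟨fun n => (h.1 n).compl, ?_⟩
  rw [← compl_internal, compl_symmDiff_compl]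
  exact h.2

theorem Approx.content_le [∀ n, Nonempty (X n)] [Nonprincipal ω] {A B : ∀ n, Set (X n)}
    {M : Set (UltraProd ω P)} (hA : Approx A M) (hB : Approx B M) :
    content ω P A ≤ content ω P B := by
  have h0 : IsNull (internal ω P fun n => A n \ B n) := by
    refine (hA.2.union hB.2).mono ?_
    rw [internal_diff]
    intro x hx
    by_cases hM : x ∈ M
    · exact Or.inr (Or.inr ⟨hM, hx.2⟩)
    · exact Or.inl (Or.inl ⟨hx.1, hM⟩)
  calc content ω P A ≤ content ω P fun n => (A n \ B n) ∪ B n :=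
        content_mono (Eventually.of_forall fun n => by
          rw [sdiff_union_self]; exact subset_union_left)
    _ ≤ (content ω P fun n => A n \ B n) + content ω P B := content_union_le _ _
    _ = content ω P B := by rw [h0.content_eq_zero, zero_add]

theorem Approx.content_eq [∀ n, Nonempty (X n)] [Nonprincipal ω] {A B : ∀ n, Set (X n)}
    {M : Set (UltraProd ω P)} (hA : Approx A M) (hB : Approx B M) :
    content ω P A = content ω P B :=
  (hA.content_le hB).antisymm (hB.content_le hA)

theorem Approx.iUnion [∀ n, IsProbabilityMeasure (P n)] [Nonprincipal ω]
    {A : ℕ → ∀ n, Set (X n)} {M : ℕ → Set (UltraProd ω P)} (h : ∀ k, Approx (A k) (M k)) :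
    ∃ C : ∀ n, Set (X n), Approx C (⋃ k, M k) ∧
      content ω P C = ⨆ k, content ω P fun n => accumulate (fun j => A j n) k := by
  set B : ℕ → ∀ n, Set (X n) := fun k n => accumulate (fun j => A j n) k with hBdef
  have hBm : ∀ k n, MeasurableSet (B k n) :=
    fun k n => measurableSet_accumulate (fun j => (h j).1 n) k
  set a : ℝ≥0∞ := ⨆ k, content ω P (B k) with ha
  have ha1 : a ≠ ∞ := ne_top_of_le_ne_top ENNReal.one_ne_top (iSup_le fun k => content_le_one _)
  obtain ⟨C, hC, hBC, hCa⟩ := saturation (ω := ω) (P := P) hBm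
    (fun n => monotone_accumulate) ha1 (fun k => le_iSup (fun k => content ω P (B k)) k)
  have hAC : ∀ k, internal ω P (A k) ⊆ internal ω P C := fun k => internal_mono <| by
    filter_upwards [hBC k] with n hn
    exact (subset_accumulate (s := fun j => A j n)).trans hn
  have hBu : ∀ k, internal ω P (B k) ⊆ ⋃ j, internal ω P (A j) := by
    intro k
    induction k with
    | zero =>
      simp only [hBdef, accumulate_zero_nat]
      exact subset_iUnion (fun j => internal ω P (A j)) 0
    | succ k ih =>
      simp only [hBdef, accumulate_succ]
      rw [internal_union]
      exact union_subset ih (subset_iUnion (fun j => internal ω P (A j)) (k + 1))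
  have hnull : IsNull (internal ω P C \ ⋃ j, internal ω P (A j)) := by
    intro ε hε
    have hex : ∃ k, a < content ω P (B k) + ε := by
      by_contra hc
      push Not at hc
      have h1 : a + ε ≤ a := by
        rw [ha, ENNReal.iSup_add]
        exact iSup_le hc
      exact absurd h1 (not_le.2 (ENNReal.lt_add_right ha1 hε.ne'))
    obtain ⟨k, hk⟩ := hex
    refine ⟨fun n => C n \ B k n, fun n => (hC n).diff (hBm k n), ?_, ?_⟩
    · rw [internal_diff]
      exact sdiff_subset_sdiff_right (hBu k)
    · have h1 := content_diff_add (P := P) (hBm k) (hBC k)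
      have h2 : (content ω P fun n => C n \ B k n) + content ω P (B k) <
          ε + content ω P (B k) := by
        rw [h1, add_comm ε]
        exact hCa.trans_lt hk
      exact lt_of_add_lt_add_right h2
  refine ⟨C, ⟨hC, ?_⟩, le_antisymm hCa (iSup_le fun k => content_mono (hBC k))⟩
  refine ((IsNull.iUnion fun k => (h k).2).union hnull).mono ?_
  rintro x (⟨hx, hM⟩ | ⟨hM, hx⟩)
  · by_cases hj : x ∈ ⋃ j, internal ω P (A j)
    · obtain ⟨j, hj⟩ := mem_iUnion.1 hj
      exact Or.inl (mem_iUnion.2 ⟨j, Or.inl ⟨hj, fun h' => hM (mem_iUnion.2 ⟨j, h'⟩)⟩⟩)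
    · exact Or.inr ⟨hx, hj⟩
  · obtain ⟨j, hj⟩ := mem_iUnion.1 hM
    exact Or.inl (mem_iUnion.2 ⟨j, Or.inr ⟨hj, fun h' => hx (hAC j h')⟩⟩)

theorem content_accumulate [∀ n, Nonempty (X n)] [Nonprincipal ω]
    {A : ℕ → ∀ n, Set (X n)} {M : ℕ → Set (UltraProd ω P)} (h : ∀ k, Approx (A k) (M k))
    (hd : Pairwise fun i j => Disjoint (M i) (M j)) (k : ℕ) :
    (content ω P fun n => accumulate (fun j => A j n) k) =
      ∑ j ∈ Finset.range (k + 1), content ω P (A j) := by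
  have hBu : ∀ k, (internal ω P fun n => accumulate (fun j => A j n) k) ⊆
      ⋃ j ≤ k, internal ω P (A j) := by
    intro k
    induction k with
    | zero =>
      simp only [accumulate_zero_nat]
      exact subset_iUnion₂ (s := fun j (_ : j ≤ 0) => internal ω P (A j)) 0 le_rfl
    | succ k ih =>
      simp only [accumulate_succ]
      rw [internal_union]
      refine union_subset (ih.trans (iUnion₂_subset fun j hj => ?_)) ?_
      · exact subset_iUnion₂ (s := fun j (_ : j ≤ k + 1) => internal ω P (A j)) j (by omega)
      · exact subset_iUnion₂ (s := fun j (_ : j ≤ k + 1) => internal ω P (A j)) (k + 1) le_rfl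
  induction k with
  | zero => simp [accumulate_zero_nat]
  | succ k ih =>
    simp only [accumulate_succ]
    rw [Finset.sum_range_succ, ← ih]
    have h0 : IsNull (internal ω P fun n => accumulate (fun j => A j n) k ∩ A (k + 1) n) := by
      refine (IsNull.iUnion fun k => (h k).2).mono ?_
      rw [internal_inter]
      rintro x ⟨hx1, hx2⟩
      obtain ⟨j, hjk, hj⟩ := mem_iUnion₂.1 (hBu k hx1)
      by_cases hM : x ∈ M (k + 1)
      · refine mem_iUnion.2 ⟨j, Or.inl ⟨hj, fun h' => ?_⟩⟩
        exact disjoint_left.1 (hd (show j ≠ k + 1 by omega)) h' hM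
      · exact mem_iUnion.2 ⟨k + 1, Or.inl ⟨hx2, hM⟩⟩
    have := content_union_add_inter (ω := ω) (P := P)
      (fun n => accumulate (fun j => A j n) k) (h (k + 1)).1
    rwa [h0.content_eq_zero, add_zero] at this

/-- The σ-algebra `𝓜` of the ultralimit: the sets that agree with the ultralimit of a sequence of
measurable sets up to a null set. -/
instance instMeasurableSpace [∀ n, IsProbabilityMeasure (P n)] [Nonprincipal ω] :
    MeasurableSpace (UltraProd ω P) where
  MeasurableSet' M := ∃ A, Approx A M
  measurableSet_empty := ⟨fun _ => ∅, fun _ => .empty, by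
    rw [internal_empty]; simpa using isNull_empty⟩
  measurableSet_compl _ := fun ⟨_, hA⟩ => ⟨_, hA.compl⟩
  measurableSet_iUnion M hM := by
    choose A hA using hM
    obtain ⟨C, hC, -⟩ := Approx.iUnion hA
    exact ⟨C, hC⟩

theorem exists_approx [∀ n, IsProbabilityMeasure (P n)] [Nonprincipal ω]
    {M : Set (UltraProd ω P)} (hM : MeasurableSet M) : ∃ A, Approx A M := hM

/-- The measure of a set `M ∈ 𝓜` is `lim_ω P n (A n)` for any measurable sets `A n` whose
ultralimit agrees with `M` up to a null set. -/
def value [∀ n, IsProbabilityMeasure (P n)] [Nonprincipal ω] (M : Set (UltraProd ω P))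
    (hM : MeasurableSet M) : ℝ≥0∞ :=
  content ω P (exists_approx hM).choose

theorem value_eq [∀ n, IsProbabilityMeasure (P n)] [Nonprincipal ω] {A : ∀ n, Set (X n)}
    {M : Set (UltraProd ω P)} (hM : MeasurableSet M) (h : Approx A M) :
    value M hM = content ω P A :=
  have : ∀ n, Nonempty (X n) := fun n => (P n).nonempty_of_neZero
  Approx.content_eq (exists_approx hM).choose_spec h

/-- The ultralimit measure. -/
instance instMeasureSpace [∀ n, IsProbabilityMeasure (P n)] [Nonprincipal ω] :
    MeasureSpace (UltraProd ω P) where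
  volume := Measure.ofMeasurable
    (fun M hM => value M hM)
    (by
      rw [← content_empty (ω := ω) (P := P)]
      refine value_eq _ ⟨fun _ => .empty, ?_⟩
      rw [internal_empty]
      simpa using isNull_empty)
    (by
      have : ∀ n, Nonempty (X n) := fun n => (P n).nonempty_of_neZero
      intro M hM hd
      choose A hA using fun k => exists_approx (hM k)
      obtain ⟨C, hC, hCc⟩ := Approx.iUnion hA
      rw [value_eq _ hC, hCc, ENNReal.tsum_eq_iSup_nat' (tendsto_add_atTop_nat 1)]
      simp only [fun k => value_eq (hM k) (hA k)]
      exact iSup_congr fun k => content_accumulate hA hd k)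

theorem volume_eq [∀ n, IsProbabilityMeasure (P n)] [Nonprincipal ω] {A : ∀ n, Set (X n)}
    {M : Set (UltraProd ω P)} (h : Approx A M) :
    (volume : Measure (UltraProd ω P)) M = content ω P A := by
  have hM : MeasurableSet M := ⟨A, h⟩
  refine (Measure.ofMeasurable_apply M hM).trans ?_
  exact value_eq _ h

end UltraProd

/-! ## The square of an ultralimit and the conditional distance -/

/-- The ultralimit of the spaces `X n × X n`; as a set it is the square of the ultralimit of the
`X n` through the two projections below, its σ-algebra is `𝓜₂`. -/
abbrev UltraSq (ω : Ultrafilter ℕ) (P : ∀ n, Measure (X n)) : Type _ :=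
  UltraProd ω fun n => (P n).prod (P n)

/-- First coordinate on the square. -/
def UltraSq.fst {ω : Ultrafilter ℕ} {P : ∀ n, Measure (X n)} (p : UltraSq ω P) : UltraProd ω P :=
  UltraProd.map (fun _ => Prod.fst) p

/-- Second coordinate on the square. -/
def UltraSq.snd {ω : Ultrafilter ℕ} {P : ∀ n, Measure (X n)} (p : UltraSq ω P) : UltraProd ω P :=
  UltraProd.map (fun _ => Prod.snd) p

/-- The product σ-algebra `𝓜 × 𝓜` on the square. -/
@[reducible] def UltraSq.prodAlgebra (ω : Ultrafilter ℕ) (P : ∀ n, Measure (X n))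
    [∀ n, IsProbabilityMeasure (P n)] [Nonprincipal ω] : MeasurableSpace (UltraSq ω P) :=
  MeasurableSpace.comap UltraSq.fst inferInstance ⊔ MeasurableSpace.comap UltraSq.snd inferInstance

end Loeb

/-- `E` is a version of the conditional expectation of `s ↦ δ_{f s}` with respect to the
sub-σ-algebra `𝓑` (Radon–Nikodym–Dunford–Pettis derivative): it is weak-* measurable with respect
to `𝓑`, and `∫_B ⟨E, g⟩ dν = ∫_B g ∘ f dν` for all `g ∈ C[0,1]` and `B ∈ 𝓑`. -/
structure IsCondDerivative {S : Type*} [MeasurableSpace S] (ν : Measure S)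
    (𝓑 : MeasurableSpace S) (f : S → I) (E : S → ProbabilityMeasure I) : Prop where
  measurable : ∀ g : C(I, ℝ), Measurable[𝓑] fun s => ∫ t, g t ∂(E s : Measure I)
  setIntegral_eq : ∀ (g : C(I, ℝ)) (B : Set S), MeasurableSet[𝓑] B →
    ∫ s in B, (∫ t, g t ∂(E s : Measure I)) ∂ν = ∫ s in B, g (f s) ∂ν

/-- `D` is (a version of) the conditional-expectation distance `d*_𝐗 = E(𝐝 | 𝓜 × 𝓜)` of the
ultralimit, where `𝐝` is the ultralimit of the functions `d n : X n × X n → [0,1]`. -/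
def IsUltraDistance {X : ℕ → Type*} [∀ n, MeasurableSpace (X n)] (ω : Ultrafilter ℕ)
    [Nonprincipal ω] (P : ∀ n, Measure (X n)) [∀ n, IsProbabilityMeasure (P n)]
    (d : ∀ n, X n × X n → I) (D : UltraSq ω P → ProbabilityMeasure I) : Prop :=
  IsCondDerivative volume (UltraSq.prodAlgebra ω P) (UltraProd.ulimFun d) D

/-- `Ψ` is a separable realization of the ultralimit of `(X n, P n, d n)` with target `(Y, μ, d*)`:
it is measurable, it pushes the ultralimit measure to `μ`, and it pulls the Borel function `d*`
back to `d*_𝐗` almost everywhere. As `d*_𝐗` is defined up to null sets, this means that versions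
of it exist and each of them agrees with the pull-back almost everywhere. -/
structure IsSeparableRealization {X : ℕ → Type*} [∀ n, MeasurableSpace (X n)] (ω : Ultrafilter ℕ)
    [Nonprincipal ω] (P : ∀ n, Measure (X n)) [∀ n, IsProbabilityMeasure (P n)]
    (d : ∀ n, X n × X n → I) {Y : Type*} [MeasurableSpace Y] (μ : Measure Y)
    (dstar : Kernel (Y × Y) I) (Ψ : UltraProd ω P → Y) : Prop where
  measurable : Measurable Ψ
  map_eq : Measure.map Ψ volume = μ
  exists_distance : ∃ D, IsUltraDistance ω P d D
  pullback_eq : ∀ D, IsUltraDistance ω P d D →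
    ∀ᵐ p : UltraSq ω P, dstar (Ψ p.fst, Ψ p.snd) = (D p : Measure I)

/-! ## Quantum metric measure spaces and their random samples -/

/-- A quantum metric measure space on the standard Borel space `X`. The Borel function `dstar` with
values in the probability measures on `[0,1]` is a Markov kernel; for almost all triples of
different points, independent random lengths satisfy the triangle inequality almost surely. -/
structure QMMSpace (X : Type*) [MeasurableSpace X] [StandardBorelSpace X] where
  μ : Measure X
  [prob : IsProbabilityMeasure μ]
  dstar : Kernel (X × X) I
  [markov : IsMarkovKernel dstar]
  dstar_self : ∀ x, dstar (x, x) = Measure.dirac 0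
  dstar_symm : ∀ x y, dstar (x, y) = dstar (y, x)
  triangle : ∀ᵐ t ∂(μ.prod (μ.prod μ)), t.1 ≠ t.2.1 → t.2.1 ≠ t.2.2 → t.1 ≠ t.2.2 →
    ∀ᵐ l ∂((dstar (t.1, t.2.1)).prod ((dstar (t.2.1, t.2.2)).prod (dstar (t.1, t.2.2)))),
      (l.1 : ℝ) ≤ l.2.1 + l.2.2 ∧ (l.2.1 : ℝ) ≤ l.1 + l.2.2 ∧ (l.2.2 : ℝ) ≤ l.1 + l.2.1

attribute [instance] QMMSpace.prob QMMSpace.markov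

/-- Pairs of indices `i < j`. -/
abbrev Edge : Type := {e : ℕ × ℕ // e.1 < e.2}

namespace QMMSpace

variable {X : Type*} [MeasurableSpace X] [StandardBorelSpace X]

/-- Given the points `x i`, the numbers `d(i,j)`, `i < j`, are independent with laws
`d*(x i, x j)`. -/
def edgeKernel (Q : QMMSpace X) : Kernel (ℕ → X) (Edge → I) where
  toFun x := Measure.infinitePi fun e : Edge => Q.dstar (x e.1.1, x e.1.2)
  measurable' := by
    refine Measurable.measure_of_isPiSystem_of_isProbabilityMeasure
      generateFrom_squareCylinders.symm
      (isPiSystem_squareCylinders (fun _ => MeasurableSpace.isPiSystem_measurableSet) (by simp)) ?_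
    · rintro _ ⟨F, t, ht', rfl⟩
      have ht : ∀ e, MeasurableSet (t e) := fun e => ht' e (mem_univ e)
      simp only [fun x : ℕ → X => Measure.infinitePi_pi
        (fun e : Edge => Q.dstar (x e.1.1, x e.1.2)) (s := F) (t := t) (fun e _ => ht e)]
      refine Finset.measurable_prod _ fun e _ => ?_
      exact (Q.dstar.measurable_coe (ht e)).comp (by fun_prop)

instance (Q : QMMSpace X) : IsMarkovKernel Q.edgeKernel :=
  ⟨fun x => inferInstanceAs (IsProbabilityMeasure
    (Measure.infinitePi fun e : Edge => Q.dstar (x e.1.1, x e.1.2)))⟩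

/-- The law of the random sample: independent `μ`-random points `x 0, x 1, …` and, given them,
independent numbers `d(i,j)`, `i < j`, with laws `d*(x i, x j)`. -/
def sampleLaw (Q : QMMSpace X) : Measure ((ℕ → X) × (Edge → I)) :=
  (Measure.infinitePi fun _ : ℕ => Q.μ) ⊗ₘ Q.edgeKernel

end QMMSpace

/-- The symmetric matrix with zero diagonal and with entries `l (i,j)` for `i < j`. -/
def sampleMatrix (l : Edge → I) (i j : ℕ) : I :=
  if h : i < j then l ⟨(i, j), h⟩ else if h : j < i then l ⟨(j, i), h⟩ else 0

/-- The uniform probability measure on the `n`-th sampled finite space, whose points are the first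
`n + 1` indices. -/
def unif (n : ℕ) : Measure (Fin (n + 1)) := uniformOn Set.univ

instance (n : ℕ) : IsProbabilityMeasure (unif n) :=
  isProbabilityMeasure_uniformOn Set.finite_univ Set.univ_nonempty

/-- The distance on the `n`-th sampled finite space. -/
def sampleDist (l : Edge → I) (n : ℕ) (p : Fin (n + 1) × Fin (n + 1)) : I :=
  sampleMatrix l p.1 p.2

/-- The natural map `i ↦ x i` on the `n`-th sampled finite space. -/
def sampleMap {X : Type*} (x : ℕ → X) (n : ℕ) (i : Fin (n + 1)) : X := x i

end QMM

end

/-!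
Integrals over internal sets of the ultralimit are ultralimits of integrals. Hence the law of large
numbers gives `π_* μ_𝐗 = μ`, and its version for pairs of sample points, together with `L¹`
approximation by continuous functions, shows that averages of a bounded Borel function of
`(x i, x j)` over a rectangle `A n ×ˢ B n` converge to the integral of its pull-back along `π × π`
over the ultralimit of the rectangles, although the function need not be continuous.

Given the points, the numbers `g (d (i, j))` are independent. By Hoeffding's inequality the sum of
their deviations from the conditional means over a fixed rectangle exceeds `ε n²` with probability
at most `exp (-c n²)`, which beats the number `4ⁿ` of rectangles, so the matrix of deviations has
small cut norm. Therefore `g ∘ 𝐝` and the pull-back of `∫ g d(d*)` have the same integrals over all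
measurable rectangles. Testing with a dense sequence of `g` identifies the joint law of `(p, q)` and
`𝐝 (p, q)`, and this says that the pull-back of `d*` is a version of `E(δ_𝐝 | 𝓜 × 𝓜)`. Versions
agree almost everywhere because `C[0,1]` is separable.
-/

namespace QMM

theorem tendsto_of_forall_exists_approx {ι Y : Type*} [PseudoMetricSpace Y] {l : Filter ι}
    {x : ι → Y} {y : Y}
    (h : ∀ ε > 0, ∃ (a : ι → Y) (b : Y), Tendsto a l (𝓝 b) ∧ (∀ᶠ i in l, dist (x i) (a i) ≤ ε) ∧
      dist b y ≤ ε) :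
    Tendsto x l (𝓝 y) := by
  rw [Metric.tendsto_nhds]
  intro ε hε
  obtain ⟨a, b, hab, hxa, hby⟩ := h (ε / 4) (by positivity)
  filter_upwards [Metric.tendsto_nhds.1 hab (ε / 4) (by positivity), hxa] with i hai hxi
  calc dist (x i) y ≤ dist (x i) (a i) + dist (a i) b + dist b y := dist_triangle4 _ _ _ _
    _ < ε := by linarith

theorem abs_floor_mul_sub_le {δ : ℝ} (hδ : 0 < δ) (t : ℝ) : |⌊t / δ⌋ * δ - t| ≤ δ := by
  have ht : t = t / δ * δ := (div_mul_cancel₀ t hδ.ne').symm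
  rw [abs_sub_comm, abs_of_nonneg]
  · nlinarith [Int.lt_floor_add_one (t / δ)]
  · nlinarith [Int.floor_le (t / δ)]

theorem abs_integral_sub_integral_le {S : Type*} [MeasurableSpace S] {ν : Measure S}
    [IsProbabilityMeasure ν] {f g : S → ℝ} (hf : Integrable f ν) (hg : Integrable g ν) {δ : ℝ}
    (h : ∀ s, |f s - g s| ≤ δ) : |∫ s, f s ∂ν - ∫ s, g s ∂ν| ≤ δ := by
  rw [← integral_sub hf hg]
  simpa only [Real.norm_eq_abs, probReal_univ, mul_one] using
    norm_integral_le_of_norm_le_const (μ := ν) (f := fun s => f s - g s) (.of_forall h)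

theorem integrable_continuousMap {Y : Type*} [TopologicalSpace Y] [CompactSpace Y]
    [MeasurableSpace Y] [OpensMeasurableSpace Y] (ν : Measure Y) [IsFiniteMeasure ν]
    (g : C(Y, ℝ)) : Integrable g ν :=
  BoundedContinuousFunction.integrable ν (.mkOfCompact g)

theorem abs_integral_continuousMap_le {Y : Type*} [TopologicalSpace Y] [CompactSpace Y]
    [MeasurableSpace Y] (ν : Measure Y) [IsProbabilityMeasure ν] (g : C(Y, ℝ)) :
    |∫ y, g y ∂ν| ≤ ‖g‖ := by
  simpa only [Real.norm_eq_abs, probReal_univ, mul_one] using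
    norm_integral_le_of_norm_le_const (μ := ν) (.of_forall g.norm_coe_le_norm)

theorem continuous_integral_continuousMap {Y : Type*} [TopologicalSpace Y] [CompactSpace Y]
    [MeasurableSpace Y] [OpensMeasurableSpace Y] (ν : Measure Y) [IsFiniteMeasure ν] :
    Continuous fun g : C(Y, ℝ) => ∫ y, g y ∂ν := by
  refine (LipschitzWith.of_dist_le_mul (K := (ν univ).toNNReal) fun g h => ?_).continuous
  rw [dist_eq_norm, ← integral_sub (integrable_continuousMap ν g) (integrable_continuousMap ν h),
    mul_comm]
  refine norm_integral_le_of_norm_le_const (.of_forall fun y => ?_)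
  exact dist_eq_norm (g y) (h y) ▸ ContinuousMap.dist_apply_le_dist y

theorem measure_ext_of_denseSeq {Y : Type*} [MetricSpace Y] [CompactSpace Y] [MeasurableSpace Y]
    [BorelSpace Y] {ν₁ ν₂ : Measure Y} [IsFiniteMeasure ν₁] [IsFiniteMeasure ν₂]
    (h : ∀ k, ∫ y, TopologicalSpace.denseSeq C(Y, ℝ) k y ∂ν₁ =
      ∫ y, TopologicalSpace.denseSeq C(Y, ℝ) k y ∂ν₂) : ν₁ = ν₂ := by
  have heq : (fun g : C(Y, ℝ) => ∫ y, g y ∂ν₁) = fun g => ∫ y, g y ∂ν₂ :=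
    (TopologicalSpace.denseRange_denseSeq C(Y, ℝ)).equalizer
      (continuous_integral_continuousMap ν₁) (continuous_integral_continuousMap ν₂) (funext h)
  exact ext_of_forall_integral_eq_of_IsFiniteMeasure fun g => congrFun heq g.toContinuousMap

namespace UltraProd

variable {X : ℕ → Type*} [∀ n, MeasurableSpace (X n)] {ω : Ultrafilter ℕ}
  {P : ∀ n, Measure (X n)}

/-- `F` is the pointwise ultralimit of the functions `f n`. Unlike `ulimFun`, this makes sense for
values in a space that is not compact. -/
def HasUlim {Y : Type*} [TopologicalSpace Y] (f : ∀ n, X n → Y) (F : UltraProd ω P → Y) : Prop :=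
  ∀ x, Tendsto (fun n => f n (x n)) ω (𝓝 (F (mk ω P x)))

theorem hasUlim_ulimFun {Y : Type*} [TopologicalSpace Y] [CompactSpace Y] (f : ∀ n, X n → Y) :
    HasUlim f (ulimFun f : UltraProd ω P → Y) :=
  fun _ => tendsto_ulim ω _

theorem HasUlim.comp_continuous {Y Z : Type*} [TopologicalSpace Y] [TopologicalSpace Z]
    {f : ∀ n, X n → Y} {F : UltraProd ω P → Y} (h : HasUlim f F) {φ : Y → Z}
    (hφ : Continuous φ) : HasUlim (fun n a => φ (f n a)) (fun p => φ (F p)) :=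
  fun x => (hφ.tendsto _).comp (h x)

theorem HasUlim.prodMk {Y Z : Type*} [TopologicalSpace Y] [TopologicalSpace Z]
    {f : ∀ n, X n → Y} {F : UltraProd ω P → Y} {g : ∀ n, X n → Z} {G : UltraProd ω P → Z}
    (hf : HasUlim f F) (hg : HasUlim g G) :
    HasUlim (fun n a => (f n a, g n a)) (fun p => (F p, G p)) :=
  fun x => (hf x).prodMk_nhds (hg x)

theorem HasUlim.indicator {f : ∀ n, X n → ℝ} {F : UltraProd ω P → ℝ} (h : HasUlim f F)
    (A : ∀ n, Set (X n)) :
    HasUlim (fun n => (A n).indicator (f n)) ((internal ω P A).indicator F) := by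
  intro x
  by_cases hx : mk ω P x ∈ internal ω P A
  · rw [indicator_of_mem hx]
    exact (h x).congr' ((mk_mem_internal.1 hx).mono fun n hn => (indicator_of_mem hn _).symm)
  · rw [indicator_of_notMem hx]
    rw [← mem_compl_iff, compl_internal, mk_mem_internal] at hx
    exact tendsto_const_nhds.congr' (hx.mono fun n hn => (indicator_of_notMem hn _).symm)

theorem HasUlim.preimage_singleton {V : Type*} [TopologicalSpace V] [DiscreteTopology V]
    {u : ∀ n, X n → V} {U : UltraProd ω P → V} (h : HasUlim u U) (v : V) :
    U ⁻¹' {v} = internal ω P fun n => u n ⁻¹' {v} := by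
  ext q
  obtain ⟨x, rfl⟩ := mk_surj q
  have hx : ∀ᶠ n in (ω : Filter ℕ), u n (x n) = U (mk ω P x) := by
    simpa only [nhds_discrete, tendsto_pure] using h x
  rw [mk_mem_internal]
  constructor
  · exact fun hq => hx.mono fun n hn => hn.trans hq
  · intro hv
    obtain ⟨n, hn, hn'⟩ := (hx.and hv).exists
    exact hn.symm.trans hn'

theorem HasUlim.preimage_isClosed {Y : Type*} [PseudoMetricSpace Y] {f : ∀ n, X n → Y}
    {F : UltraProd ω P → Y} (h : HasUlim f F) {K : Set Y} (hK : IsClosed K) :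
    F ⁻¹' K = ⋂ k : ℕ, internal ω P fun n => f n ⁻¹' Metric.thickening (1 / (k + 1 : ℝ)) K := by
  ext q
  obtain ⟨x, rfl⟩ := mk_surj q
  simp only [mem_iInter, mk_mem_internal, mem_preimage]
  constructor
  · exact fun hq k => (h x).eventually
      (Metric.isOpen_thickening.mem_nhds (Metric.self_subset_thickening (by positivity) K hq))
  · intro hq
    rw [← hK.closure_eq, Metric.closure_eq_iInter_cthickening, mem_iInter₂]
    intro δ hδ
    obtain ⟨k, hk⟩ := exists_nat_one_div_lt hδ
    refine Metric.isClosed_cthickening.mem_of_tendsto (h x) ((hq k).mono fun n hn => ?_)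
    exact Metric.thickening_subset_cthickening_of_le hk.le K hn

theorem approx_internal {A : ∀ n, Set (X n)} (hA : ∀ n, MeasurableSet (A n)) :
    Approx A (internal ω P A) :=
  ⟨hA, by simpa only [symmDiff_self, bot_eq_empty] using isNull_empty⟩

variable [∀ n, IsProbabilityMeasure (P n)] [Nonprincipal ω]

theorem measurableSet_internal {A : ∀ n, Set (X n)} (hA : ∀ n, MeasurableSet (A n)) :
    MeasurableSet (internal ω P A) :=
  ⟨A, approx_internal hA⟩

theorem volume_internal {A : ∀ n, Set (X n)} (hA : ∀ n, MeasurableSet (A n)) :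
    volume (internal ω P A) = content ω P A :=
  volume_eq (approx_internal hA)

instance : IsProbabilityMeasure (volume : Measure (UltraProd ω P)) where
  measure_univ := by
    have huniv : internal ω P (fun _ => univ) = univ := by
      simpa only [internal_empty, compl_empty] using
        (compl_internal (ω := ω) (P := P) fun _ => ∅).symm
    rw [← huniv, volume_internal fun _ => .univ]
    exact tendsto_nhds_unique (tendsto_content _) (by simp)

theorem IsNull.volume_eq_zero {N : Set (UltraProd ω P)} (h : IsNull N) : volume N = 0 := by
  have happrox : Approx (fun _ => ∅) N :=
    ⟨fun _ => .empty, by rwa [internal_empty, ← bot_eq_empty, bot_symmDiff]⟩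
  rw [volume_eq happrox, content_empty]

theorem Approx.ae_eq {A : ∀ n, Set (X n)} {M : Set (UltraProd ω P)} (h : Approx A M) :
    internal ω P A =ᵐ[volume] M :=
  measure_symmDiff_eq_zero_iff.1 h.2.volume_eq_zero

theorem tendsto_measureReal_internal {A : ∀ n, Set (X n)} (hA : ∀ n, MeasurableSet (A n)) :
    Tendsto (fun n => (P n).real (A n)) ω (𝓝 (volume.real (internal ω P A))) := by
  have h := tendsto_content (ω := ω) (P := P) A
  rw [← volume_internal hA] at h
  exact (ENNReal.tendsto_toReal (measure_ne_top _ _)).comp h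

theorem HasUlim.measurable {Y : Type*} [PseudoMetricSpace Y] [MeasurableSpace Y] [BorelSpace Y]
    {f : ∀ n, X n → Y} {F : UltraProd ω P → Y} (h : HasUlim f F) (hf : ∀ n, Measurable (f n)) :
    Measurable F := by
  refine measurable_of_isClosed fun K hK => ?_
  rw [h.preimage_isClosed hK]
  exact .iInter fun k => measurableSet_internal fun n =>
    hf n Metric.isOpen_thickening.measurableSet

theorem HasUlim.tendsto_integral_comp_of_discrete {V : Type*} [Finite V] [TopologicalSpace V]
    [DiscreteTopology V] [MeasurableSpace V] [MeasurableSingletonClass V] {u : ∀ n, X n → V}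
    {U : UltraProd ω P → V} (h : HasUlim u U) (hu : ∀ n, Measurable (u n)) (φ : V → ℝ) :
    Tendsto (fun n => ∫ a, φ (u n a) ∂(P n)) ω (𝓝 (∫ p, φ (U p))) := by
  have := Fintype.ofFinite V
  have hUset (v : V) : MeasurableSet (U ⁻¹' {v}) := by
    rw [h.preimage_singleton]
    exact measurableSet_internal fun n => hu n (measurableSet_singleton v)
  have hU : Measurable U := measurable_to_countable' hUset
  have integral_eq_sum {S : Type _} [MeasurableSpace S] (ν : Measure S) [IsProbabilityMeasure ν]
      {w : S → V} (hw : Measurable w) :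
      ∫ s, φ (w s) ∂ν = ∑ v, ν.real (w ⁻¹' {v}) * φ v := by
    have := Measure.isProbabilityMeasure_map (μ := ν) hw.aemeasurable
    rw [← integral_map hw.aemeasurable Measurable.of_discrete.aestronglyMeasurable,
      integral_fintype .of_finite]
    simp only [map_measureReal_apply hw (measurableSet_singleton _), smul_eq_mul]
  rw [integral_eq_sum _ hU, funext fun n => integral_eq_sum (P n) (hu n)]
  refine tendsto_finsetSum _ fun v _ => Tendsto.mul_const _ ?_
  rw [h.preimage_singleton]
  exact tendsto_measureReal_internal fun n => hu n (measurableSet_singleton v)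

theorem HasUlim.tendsto_integral {f : ∀ n, X n → ℝ} {F : UltraProd ω P → ℝ} (h : HasUlim f F)
    (hf : ∀ n, Measurable (f n)) {C : ℝ} (hC : ∀ n a, |f n a| ≤ C) :
    Tendsto (fun n => ∫ a, f n a ∂(P n)) ω (𝓝 (∫ p, F p)) := by
  have hFC (p) : |F p| ≤ C := by
    obtain ⟨x, rfl⟩ := mk_surj p
    exact le_of_tendsto' (h x).abs fun n => hC n _
  refine tendsto_of_forall_exists_approx fun δ hδ => ?_
  -- Rounding to multiples of `δ` gives functions into a finite set that does not depend on `n`.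
  let V := Finset.Icc ⌊-C / δ⌋ ⌊C / δ⌋
  let φ (v : V) : ℝ := (v : ℤ) * δ
  let u (n) (a : X n) : V := ⟨⌊f n a / δ⌋, by
    obtain ⟨h₁, h₂⟩ := abs_le.1 (hC n a)
    exact Finset.mem_Icc.2 ⟨Int.floor_mono (by gcongr), Int.floor_mono (by gcongr)⟩⟩
  have hu (n) : Measurable (u n) :=
    (Int.measurable_floor.comp ((hf n).div_const δ)).subtype_mk
  have hU : HasUlim u (ulimFun u : UltraProd ω P → V) := hasUlim_ulimFun u
  have hφU : HasUlim (fun n a => φ (u n a)) (fun p : UltraProd ω P => φ (ulimFun u p)) :=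
    hU.comp_continuous continuous_of_discreteTopology
  have hφf (n) (a : X n) : |φ (u n a) - f n a| ≤ δ := abs_floor_mul_sub_le hδ _
  have hφF (p : UltraProd ω P) : |φ (ulimFun u p) - F p| ≤ δ := by
    obtain ⟨x, rfl⟩ := mk_surj p
    exact le_of_tendsto' ((hφU x).sub (h x)).abs fun n => hφf n _
  have hφi {S : Type _} [MeasurableSpace S] (ν : Measure S) [IsProbabilityMeasure ν] {w : S → V}
      (hw : Measurable w) : Integrable (fun s => φ (w s)) ν :=
    (Integrable.of_finite (f := φ)).comp_measurable hw
  have hfi (n) : Integrable (f n) (P n) :=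
    .of_bound (hf n).aestronglyMeasurable C (.of_forall (hC n))
  have hFi : Integrable F := .of_bound (h.measurable hf).aestronglyMeasurable C (.of_forall hFC)
  refine ⟨_, _, hU.tendsto_integral_comp_of_discrete hu φ, .of_forall fun n => ?_, ?_⟩
  · rw [dist_comm]
    exact abs_integral_sub_integral_le (hφi _ (hu n)) (hfi n) (hφf n)
  · exact abs_integral_sub_integral_le (hφi _ (hU.measurable hu)) hFi hφF

theorem HasUlim.tendsto_setIntegral {f : ∀ n, X n → ℝ} {F : UltraProd ω P → ℝ} (h : HasUlim f F)
    (hf : ∀ n, Measurable (f n)) {C : ℝ} (hC : ∀ n a, |f n a| ≤ C)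
    {A : ∀ n, Set (X n)} (hA : ∀ n, MeasurableSet (A n)) :
    Tendsto (fun n => ∫ a in A n, f n a ∂(P n)) ω (𝓝 (∫ p in internal ω P A, F p)) := by
  simp only [← integral_indicator (measurableSet_internal hA), ← fun n =>
    integral_indicator (μ := P n) (f := f n) (hA n)]
  exact (h.indicator A).tendsto_integral (fun n => (hf n).indicator (hA n)) fun n a =>
    (norm_indicator_le_norm_self (f n) a).trans (hC n a)

end UltraProd

namespace UltraProd

variable {X Y : ℕ → Type*} [∀ n, MeasurableSpace (X n)] [∀ n, MeasurableSpace (Y n)]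
  {ω : Ultrafilter ℕ} {P : ∀ n, Measure (X n)} {R : ∀ n, Measure (Y n)} {f : ∀ n, X n → Y n}

theorem preimage_map_internal (f : ∀ n, X n → Y n) (A : ∀ n, Set (Y n)) :
    map f ⁻¹' internal ω R A = internal ω P fun n => f n ⁻¹' A n := by
  ext q
  obtain ⟨x, rfl⟩ := mk_surj q
  change mk ω R (fun n => f n (x n)) ∈ internal ω R A ↔ _
  simp only [mk_mem_internal, mem_preimage]

theorem HasUlim.comp_map {Z : Type*} [TopologicalSpace Z] {g : ∀ n, Y n → Z}
    {G : UltraProd ω R → Z} (h : HasUlim g G) (f : ∀ n, X n → Y n) :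
    HasUlim (fun n a => g n (f n a)) (fun p : UltraProd ω P => G (map f p)) :=
  fun x => h fun n => f n (x n)

theorem IsNull.preimage_map (hf : ∀ n, MeasurePreserving (f n) (P n) (R n))
    {N : Set (UltraProd ω R)} (h : IsNull N) : IsNull (map f ⁻¹' N : Set (UltraProd ω P)) := by
  intro ε hε
  obtain ⟨A, hA, hN, hAε⟩ := h ε hε
  refine ⟨fun n => f n ⁻¹' A n, fun n => (hf n).measurable (hA n), ?_, ?_⟩
  · exact preimage_map_internal (P := P) f A ▸ preimage_mono hN
  · simpa only [content, fun n => (hf n).measure_preimage (hA n).nullMeasurableSet] using hAε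

theorem Approx.preimage_map (hf : ∀ n, MeasurePreserving (f n) (P n) (R n))
    {A : ∀ n, Set (Y n)} {M : Set (UltraProd ω R)} (h : Approx A M) :
    Approx (fun n => f n ⁻¹' A n) (map f ⁻¹' M : Set (UltraProd ω P)) :=
  ⟨fun n => (hf n).measurable (h.1 n), by
    rw [← preimage_map_internal, ← preimage_symmDiff]
    exact h.2.preimage_map hf⟩

theorem measurable_map [∀ n, IsProbabilityMeasure (P n)] [∀ n, IsProbabilityMeasure (R n)]
    [Nonprincipal ω] (hf : ∀ n, MeasurePreserving (f n) (P n) (R n)) :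
    Measurable (map f : UltraProd ω P → UltraProd ω R) :=
  fun _ ⟨_, h⟩ => ⟨_, h.preimage_map hf⟩

end UltraProd

namespace UltraSq

open UltraProd

variable {X : ℕ → Type*} [∀ n, MeasurableSpace (X n)] {ω : Ultrafilter ℕ} [Nonprincipal ω]
  {P : ∀ n, Measure (X n)} [∀ n, IsProbabilityMeasure (P n)]

theorem measurable_fst : Measurable (fst : UltraSq ω P → UltraProd ω P) :=
  measurable_map fun _ => measurePreserving_fst

theorem measurable_snd : Measurable (snd : UltraSq ω P → UltraProd ω P) :=
  measurable_map fun _ => measurePreserving_snd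

theorem measurable_fst_snd : Measurable fun p : UltraSq ω P => (p.fst, p.snd) :=
  measurable_fst.prodMk measurable_snd

theorem prodAlgebra_eq_comap :
    prodAlgebra ω P = MeasurableSpace.comap (fun p => (p.fst, p.snd)) inferInstance :=
  (MeasurableSpace.comap_prodMk _ _).symm

theorem prodAlgebra_le :
    prodAlgebra ω P ≤ (inferInstance : MeasurableSpace (UltraSq ω P)) :=
  prodAlgebra_eq_comap (ω := ω) (P := P) ▸ measurable_fst_snd.comap_le

theorem internal_prod_ae_eq {A B : ∀ n, Set (X n)} {M N : Set (UltraProd ω P)}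
    (hA : Approx A M) (hB : Approx B N) :
    internal ω (fun n => (P n).prod (P n)) (fun n => A n ×ˢ B n) =ᵐ[volume]
      (fun p : UltraSq ω P => (p.fst, p.snd)) ⁻¹' (M ×ˢ N) := by
  have hprod (n) : A n ×ˢ B n = Prod.fst ⁻¹' A n ∩ Prod.snd ⁻¹' B n := rfl
  rw [funext hprod, internal_inter]
  exact (hA.preimage_map fun _ => measurePreserving_fst).ae_eq.inter
    (hB.preimage_map fun _ => measurePreserving_snd).ae_eq

theorem measurePreserving_fst_snd :
    MeasurePreserving (fun p : UltraSq ω P => (p.fst, p.snd)) volume (volume.prod volume) := by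
  refine ⟨measurable_fst_snd, (Measure.prod_eq fun M N hM hN => ?_).symm⟩
  obtain ⟨A, hA⟩ := exists_approx hM
  obtain ⟨B, hB⟩ := exists_approx hN
  have content_ne_top (A : ∀ n, Set (X n)) : content ω P A ≠ ∞ :=
    ne_top_of_le_ne_top ENNReal.one_ne_top (content_le_one A)
  rw [Measure.map_apply measurable_fst_snd (hM.prod hN),
    ← measure_congr (internal_prod_ae_eq hA hB), volume_eq hA, volume_eq hB,
    volume_internal fun n => (hA.1 n).prod (hB.1 n)]
  refine tendsto_nhds_unique (tendsto_content _) ?_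
  simp only [Measure.prod_prod]
  exact ENNReal.Tendsto.mul (tendsto_content A) (.inr (content_ne_top B)) (tendsto_content B)
    (.inr (content_ne_top A))

end UltraSq

section ConditionalLaw

variable {S T₁ T₂ Y : Type*} [MeasurableSpace S] [MeasurableSpace T₁] [MeasurableSpace T₂]
  [MetricSpace Y] [MeasurableSpace Y] [BorelSpace Y]

theorem measurable_integral_kernel (η : Kernel S Y) (g : C(Y, ℝ)) :
    Measurable fun s => ∫ y, g y ∂η s :=
  (StronglyMeasurable.integral_kernel g.continuous.stronglyMeasurable).measurable

theorem setIntegral_map_prodMk {T : Type*} [MeasurableSpace T] {ν : Measure S} {τ : S → T}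
    (hτ : Measurable τ) {f : S → Y} (hf : Measurable f) {B : Set T} (hB : MeasurableSet B)
    (g : C(Y, ℝ)) :
    ∫ p in B ×ˢ univ, g p.2 ∂(ν.map fun s => (τ s, f s)) = ∫ s in τ ⁻¹' B, g (f s) ∂ν := by
  have hg : Measurable fun p : T × Y => g p.2 := g.continuous.measurable.comp measurable_snd
  rw [setIntegral_map (hB.prod .univ) hg.aestronglyMeasurable (hτ.prodMk hf).aemeasurable,
    mk_preimage_prod, preimage_univ, inter_univ]

variable [CompactSpace Y]

theorem integrable_comp_continuousMap {ν : Measure S} [IsFiniteMeasure ν] {f : S → Y}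
    (hf : Measurable f) (g : C(Y, ℝ)) : Integrable (fun s => g (f s)) ν :=
  (integrable_continuousMap (ν.map f) g).comp_measurable hf

theorem measure_ext_of_setIntegral_denseSeq {ρ₁ ρ₂ : Measure ((T₁ × T₂) × Y)} [IsFiniteMeasure ρ₁]
    [IsFiniteMeasure ρ₂] (h : ∀ M N, MeasurableSet M → MeasurableSet N → ∀ k,
      ∫ p in (M ×ˢ N) ×ˢ univ, TopologicalSpace.denseSeq C(Y, ℝ) k p.2 ∂ρ₁ =
        ∫ p in (M ×ˢ N) ×ˢ univ, TopologicalSpace.denseSeq C(Y, ℝ) k p.2 ∂ρ₂) :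
    ρ₁ = ρ₂ := by
  refine Measure.ext_prod₃' fun {M N E} hM hN hE => ?_
  have hsnd : (ρ₁.restrict ((M ×ˢ N) ×ˢ univ)).snd = (ρ₂.restrict ((M ×ˢ N) ×ˢ univ)).snd := by
    refine measure_ext_of_denseSeq fun k => ?_
    rw [Measure.snd, Measure.snd, integral_map measurable_snd.aemeasurable,
      integral_map measurable_snd.aemeasurable, h M N hM hN k]
    all_goals exact (ContinuousMap.continuous _).aestronglyMeasurable
  have snd_apply (ρ : Measure ((T₁ × T₂) × Y)) :
      (ρ.restrict ((M ×ˢ N) ×ˢ univ)).snd E = ρ ((M ×ˢ N) ×ˢ E) := by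
    rw [Measure.snd_apply hE, Measure.restrict_apply (measurable_snd hE), ← univ_prod,
      prod_inter_prod, univ_inter, inter_univ]
  rw [← snd_apply ρ₁, hsnd, snd_apply]

theorem setIntegral_map_compProd {T : Type*} [MeasurableSpace T] {ν : Measure S}
    [IsFiniteMeasure ν] {τ : S → T} (hτ : Measurable τ) (η : Kernel T Y) [IsFiniteKernel η]
    {B : Set T} (hB : MeasurableSet B) (g : C(Y, ℝ)) :
    ∫ p in B ×ˢ univ, g p.2 ∂(ν.map τ ⊗ₘ η) = ∫ s in τ ⁻¹' B, ∫ y, g y ∂η (τ s) ∂ν := by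
  rw [Measure.setIntegral_compProd hB .univ
    (integrable_comp_continuousMap measurable_snd g).integrableOn]
  simp only [Measure.restrict_univ]
  exact setIntegral_map hB (measurable_integral_kernel η g).aestronglyMeasurable hτ.aemeasurable

theorem map_prodMk_eq_compProd_of_setIntegral {ν : Measure S} [IsFiniteMeasure ν]
    {τ : S → T₁ × T₂} (hτ : Measurable τ) {f : S → Y} (hf : Measurable f) (η : Kernel (T₁ × T₂) Y)
    [IsFiniteKernel η] (h : ∀ M N, MeasurableSet M → MeasurableSet N → ∀ k,
      ∫ s in τ ⁻¹' (M ×ˢ N), TopologicalSpace.denseSeq C(Y, ℝ) k (f s) ∂ν =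
        ∫ s in τ ⁻¹' (M ×ˢ N), ∫ y, TopologicalSpace.denseSeq C(Y, ℝ) k y ∂η (τ s) ∂ν) :
    ν.map (fun s => (τ s, f s)) = ν.map τ ⊗ₘ η :=
  measure_ext_of_setIntegral_denseSeq fun M N hM hN k => by
    rw [setIntegral_map_prodMk hτ hf (hM.prod hN), setIntegral_map_compProd hτ η (hM.prod hN),
      h M N hM hN k]

theorem isCondDerivative_of_map_prodMk_eq {T : Type*} [mT : MeasurableSpace T] {ν : Measure S}
    [IsFiniteMeasure ν] {τ : S → T} (hτ : Measurable τ) {f : S → I} (hf : Measurable f)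
    {η : Kernel T I} [IsMarkovKernel η] (h : ν.map (fun s => (τ s, f s)) = ν.map τ ⊗ₘ η) :
    IsCondDerivative ν (mT.comap τ) f fun s => ⟨η (τ s), inferInstance⟩ where
  measurable g := (measurable_integral_kernel η g).comp (comap_measurable τ)
  setIntegral_eq g := by
    rintro _ ⟨B, hB, rfl⟩
    rw [← setIntegral_map_prodMk hτ hf hB, h, setIntegral_map_compProd hτ η hB]
    rfl

end ConditionalLaw

theorem IsCondDerivative.ae_eq {S : Type*} {𝓑 mS : MeasurableSpace S} {ν : Measure S}
    [IsFiniteMeasure ν] (h𝓑 : 𝓑 ≤ mS) {f : S → I} {D E : S → ProbabilityMeasure I}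
    (hD : IsCondDerivative ν 𝓑 f D) (hE : IsCondDerivative ν 𝓑 f E) :
    ∀ᵐ s ∂ν, (D s : Measure I) = E s := by
  have integrable {D : S → ProbabilityMeasure I} (hD : IsCondDerivative ν 𝓑 f D) (g : C(I, ℝ)) :
      Integrable (fun s => ∫ t, g t ∂(D s : Measure I)) ν :=
    .of_bound ((hD.measurable g).mono h𝓑 le_rfl).aestronglyMeasurable ‖g‖
      (.of_forall fun s => abs_integral_continuousMap_le (D s : Measure I) g)
  have hk (k) : ∀ᵐ s ∂ν, ∫ t, TopologicalSpace.denseSeq C(I, ℝ) k t ∂(D s : Measure I) =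
      ∫ t, TopologicalSpace.denseSeq C(I, ℝ) k t ∂(E s : Measure I) :=
    ae_eq_of_forall_setIntegral_eq_of_sigmaFinite' h𝓑
      (fun _ _ _ => (integrable hD _).integrableOn) (fun _ _ _ => (integrable hE _).integrableOn)
      (fun B hB _ => (hD.setIntegral_eq _ B hB).trans (hE.setIntegral_eq _ B hB).symm)
      (hD.measurable _).stronglyMeasurable.aestronglyMeasurable
      (hE.measurable _).stronglyMeasurable.aestronglyMeasurable
  filter_upwards [ae_all_iff.2 hk] with s hs
  exact measure_ext_of_denseSeq hs

section ProductMeasures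

variable {ι Ω : Type*} {F : ι → Type*} [∀ i, MeasurableSpace (F i)]

theorem hasSubgaussianMGF_mono [MeasurableSpace Ω] {ν : Measure Ω} {Z : Ω → ℝ} {c c' : NNReal}
    (h : HasSubgaussianMGF Z c ν) (hc : c ≤ c') : HasSubgaussianMGF Z c' ν :=
  ⟨h.integrable_exp_mul, fun t => (h.mgf_le t).trans <| Real.exp_le_exp.2 <| by gcongr⟩

theorem measureReal_le_sum_infinitePi_le {ν : ∀ i, Measure (F i)}
    [∀ i, IsProbabilityMeasure (ν i)] {h : ∀ i, F i → ℝ} (hm : ∀ i, Measurable (h i)) {C : ℝ}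
    (hC : ∀ i a, |h i a| ≤ C) (h0 : ∀ i, ∫ a, h i a ∂(ν i) = 0) {s : Finset ι} {M : ℝ}
    (hM : s.card * C ^ 2 ≤ M) {t : ℝ} (ht : 0 ≤ t) :
    (Measure.infinitePi ν).real {x | t ≤ ∑ i ∈ s, h i (x i)} ≤ Real.exp (-t ^ 2 / (2 * M)) := by
  have hsub (i : ι) : HasSubgaussianMGF (fun x : ∀ i, F i => h i (x i)) ((‖C - -C‖₊ / 2) ^ 2)
      (Measure.infinitePi ν) := by
    have hp := measurePreserving_eval_infinitePi ν i
    refine hasSubgaussianMGF_of_mem_Icc_of_integral_eq_zero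
      ((hm i).comp (measurable_pi_apply i)).aemeasurable
      (.of_forall fun x => abs_le.1 (hC i (x i))) ?_
    rw [← h0 i, ← hp.map_eq]
    exact (integral_map hp.measurable.aemeasurable (hm i).aestronglyMeasurable).symm
  have hsum : ∑ _i ∈ s, (‖C - -C‖₊ / 2) ^ 2 ≤ M.toNNReal := by
    refine NNReal.le_toNNReal_of_coe_le (le_trans (le_of_eq ?_) hM)
    simp only [Finset.sum_const, nsmul_eq_mul, NNReal.coe_mul, NNReal.coe_natCast,
      NNReal.coe_pow, NNReal.coe_div, coe_nnnorm, Real.norm_eq_abs, NNReal.coe_ofNat]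
    rw [sub_neg_eq_add, ← two_mul, div_pow, sq_abs]
    ring
  have h := (hasSubgaussianMGF_mono (HasSubgaussianMGF.sum_of_iIndepFun
    (iIndepFun_infinitePi hm) fun i _ => hsub i) hsum).measure_ge_le ht
  rwa [Real.coe_toNNReal M (le_trans (by positivity) hM)] at h

theorem measure_le_abs_sum_infinitePi_le {ν : ∀ i, Measure (F i)}
    [∀ i, IsProbabilityMeasure (ν i)] {h : ∀ i, F i → ℝ} (hm : ∀ i, Measurable (h i)) {C : ℝ}
    (hC : ∀ i a, |h i a| ≤ C) (h0 : ∀ i, ∫ a, h i a ∂(ν i) = 0) {s : Finset ι} {M : ℝ}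
    (hM : s.card * C ^ 2 ≤ M) {t : ℝ} (ht : 0 ≤ t) :
    Measure.infinitePi ν {x | t ≤ |∑ i ∈ s, h i (x i)|} ≤
      ENNReal.ofReal (2 * Real.exp (-t ^ 2 / (2 * M))) := by
  have hpos := measureReal_le_sum_infinitePi_le hm hC h0 hM ht
  have hneg := measureReal_le_sum_infinitePi_le (h := fun i a => -h i a) (fun i => (hm i).neg)
    (by simpa only [abs_neg] using hC) (fun i => by rw [integral_neg, h0, neg_zero]) hM ht
  have hunion : {x : ∀ i, F i | t ≤ |∑ i ∈ s, h i (x i)|} ⊆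
      {x | t ≤ ∑ i ∈ s, h i (x i)} ∪ {x | t ≤ ∑ i ∈ s, -h i (x i)} := fun x hx => by
    simpa only [mem_union, mem_ofPred_eq, Finset.sum_neg_distrib] using le_abs.1 hx
  rw [← ofReal_measureReal]
  refine ENNReal.ofReal_le_ofReal ((measureReal_mono hunion).trans ?_)
  linarith [measureReal_union_le (μ := Measure.infinitePi ν) {x | t ≤ ∑ i ∈ s, h i (x i)}
    {x | t ≤ ∑ i ∈ s, -h i (x i)}]

/-- The kernel that draws the coordinates of a point of a product independently, the `i`-th one
from `κ i`. -/
noncomputable def infinitePiKernel [MeasurableSpace Ω] (κ : ∀ i, Kernel Ω (F i))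
    [∀ i, IsMarkovKernel (κ i)] : Kernel Ω (∀ i, F i) where
  toFun a := Measure.infinitePi fun i => κ i a
  measurable' := by
    refine Measurable.measure_of_isPiSystem_of_isProbabilityMeasure
      generateFrom_squareCylinders.symm
      (isPiSystem_squareCylinders (fun _ => MeasurableSpace.isPiSystem_measurableSet) (by simp)) ?_
    rintro _ ⟨s, t, ht, rfl⟩
    simp only [Measure.infinitePi_pi _ fun i _ => ht i (mem_univ i)]
    exact Finset.measurable_prod _ fun i _ => (κ i).measurable_coe (ht i (mem_univ i))

instance [MeasurableSpace Ω] (κ : ∀ i, Kernel Ω (F i)) [∀ i, IsMarkovKernel (κ i)] :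
    IsMarkovKernel (infinitePiKernel κ) :=
  ⟨fun a => inferInstanceAs (IsProbabilityMeasure (Measure.infinitePi fun i => κ i a))⟩

theorem compProd_apply_le_of_forall_le [MeasurableSpace Ω] {Y : Type*} [MeasurableSpace Y]
    {ρ : Measure Ω} [IsProbabilityMeasure ρ] {η : Kernel Ω Y} [IsSFiniteKernel η]
    {S : Set (Ω × Y)} (hS : MeasurableSet S) {b : ℝ≥0∞} (h : ∀ a, η a (Prod.mk a ⁻¹' S) ≤ b) :
    (ρ ⊗ₘ η) S ≤ b :=
  calc (ρ ⊗ₘ η) S = ∫⁻ a, η a (Prod.mk a ⁻¹' S) ∂ρ := Measure.compProd_apply hS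
    _ ≤ ∫⁻ _, b ∂ρ := lintegral_mono h
    _ = b := by simp

theorem measure_le_abs_sum_compProd_infinitePiKernel_le [MeasurableSpace Ω] {ρ : Measure Ω}
    [IsProbabilityMeasure ρ] {κ : ∀ i, Kernel Ω (F i)} [∀ i, IsMarkovKernel (κ i)]
    {h : ∀ i, Ω × F i → ℝ} (hm : ∀ i, Measurable (h i)) {C : ℝ} (hC : ∀ i p, |h i p| ≤ C)
    (h0 : ∀ i a, ∫ b, h i (a, b) ∂(κ i a) = 0) {s : Finset ι} {M : ℝ}
    (hM : s.card * C ^ 2 ≤ M) {t : ℝ} (ht : 0 ≤ t) :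
    (ρ ⊗ₘ infinitePiKernel κ) {p | t ≤ |∑ i ∈ s, h i (p.1, p.2 i)|} ≤
      ENNReal.ofReal (2 * Real.exp (-t ^ 2 / (2 * M))) :=
  compProd_apply_le_of_forall_le (measurableSet_le measurable_const (by fun_prop)) fun a =>
    measure_le_abs_sum_infinitePi_le (fun i => (hm i).comp measurable_prodMk_left)
      (fun i b => hC i (a, b)) (fun i => h0 i a) hM ht

theorem ae_tendsto_zero_of_summable [MeasurableSpace Ω] {ν : Measure Ω} {f : ℕ → Ω → ℝ}
    {b : ℝ → ℕ → ℝ} (hb : ∀ ε, 0 < ε → Summable (b ε))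
    (hf : ∀ ε, 0 < ε → ∀ n, ν {x | ε ≤ |f n x|} ≤ ENNReal.ofReal (b ε n)) :
    ∀ᵐ x ∂ν, Tendsto (fun n => f n x) atTop (𝓝 0) := by
  have hbound (k : ℕ) : ∀ᵐ x ∂ν, ∀ᶠ n in atTop, |f n x| < 1 / ((k : ℝ) + 1) := by
    have hk : (0 : ℝ) < 1 / (k + 1) := by positivity
    simpa only [mem_ofPred_eq, not_le] using ae_eventually_notMem (ne_top_of_le_ne_top
      (hb _ hk).tsum_ofReal_ne_top (ENNReal.tsum_le_tsum (hf _ hk)))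
  filter_upwards [ae_all_iff.2 hbound] with x hx
  refine Metric.tendsto_nhds.2 fun ε hε => ?_
  obtain ⟨k, hk⟩ := exists_nat_one_div_lt hε
  filter_upwards [hx k] with n hn
  simpa using hn.trans hk

theorem measurePreserving_update [DecidableEq ι] (ν : ∀ i, Measure (F i))
    [∀ i, IsProbabilityMeasure (ν i)] (j : ι) :
    MeasurePreserving (fun p : F j × (∀ i, F i) => Function.update p.2 j p.1)
      ((ν j).prod (Measure.infinitePi ν)) (Measure.infinitePi ν) := by
  have hm : Measurable fun p : F j × (∀ i, F i) => Function.update p.2 j p.1 := by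
    refine measurable_pi_iff.2 fun i => ?_
    obtain rfl | hi := eq_or_ne i j
    · simpa using measurable_fst
    · simp only [Function.update_of_ne hi]
      fun_prop
  refine ⟨hm, Measure.eq_infinitePi _ fun s t ht => ?_⟩
  have hpre : (fun p : F j × (∀ i, F i) => Function.update p.2 j p.1) ⁻¹' (s : Set ι).pi t =
      (if j ∈ s then t j else univ) ×ˢ ((s.erase j : Finset ι) : Set ι).pi t := by
    ext p
    simp only [mem_preimage, Set.mem_pi, mem_prod, Finset.mem_coe, Finset.mem_erase]
    refine ⟨fun h => ⟨?_, fun i hi => ?_⟩, fun h i hi => ?_⟩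
    · split_ifs with hj
      · simpa using h j hj
      · exact mem_univ _
    · simpa [Function.update_of_ne hi.1] using h i hi.2
    · obtain rfl | hij := eq_or_ne i j
      · simpa [hi] using h.1
      · simpa [Function.update_of_ne hij] using h.2 i ⟨hij, hi⟩
  rw [Measure.map_apply hm (.pi s.countable_toSet fun i _ => ht i), hpre, Measure.prod_prod,
    Measure.infinitePi_pi _ fun i _ => ht i]
  split_ifs with hj
  · exact Finset.mul_prod_erase s (fun i => ν i (t i)) hj
  · rw [measure_univ, one_mul, Finset.erase_eq_of_notMem hj]

end ProductMeasures

theorem measureReal_unif_singleton (n : ℕ) (i : Fin (n + 1)) :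
    (unif n).real {i} = ((n : ℝ) + 1)⁻¹ := by
  have hcard : ((n : ℝ≥0∞) + 1).toReal = (n : ℝ) + 1 := by
    exact_mod_cast ENNReal.toReal_natCast (n + 1)
  simp [unif, measureReal_def, uniformOn_univ, hcard]

theorem integral_unif (n : ℕ) (f : Fin (n + 1) → ℝ) :
    ∫ i, f i ∂(unif n) = (∑ i, f i) / ((n : ℝ) + 1) := by
  simp only [integral_fintype .of_finite, measureReal_unif_singleton, smul_eq_mul,
    ← Finset.mul_sum, div_eq_inv_mul]

theorem integral_unif_prod (n : ℕ) (f : Fin (n + 1) × Fin (n + 1) → ℝ) :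
    ∫ p, f p ∂((unif n).prod (unif n)) = (∑ i, ∑ j, f (i, j)) / ((n : ℝ) + 1) ^ 2 := by
  rw [integral_prod f .of_finite, integral_unif]
  simp only [integral_unif, ← Finset.sum_div, div_div, sq]

theorem abs_setIntegral_unif_prod_sub_le {n : ℕ} {f g : Fin (n + 1) × Fin (n + 1) → ℝ}
    (hfg : ∀ p, p.1 ≠ p.2 → f p = g p) {C : ℝ} (hC : ∀ p, |f p - g p| ≤ C)
    (S : Set (Fin (n + 1) × Fin (n + 1))) :
    |∫ p in S, f p ∂((unif n).prod (unif n)) - ∫ p in S, g p ∂((unif n).prod (unif n))| ≤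
      C / ((n : ℝ) + 1) :=
  calc |∫ p in S, f p ∂((unif n).prod (unif n)) - ∫ p in S, g p ∂((unif n).prod (unif n))|
      ≤ ∫ p in S, |f p - g p| ∂((unif n).prod (unif n)) := by
        rw [← integral_sub .of_finite .of_finite]
        exact abs_integral_le_integral_abs
    _ ≤ ∫ p, |f p - g p| ∂((unif n).prod (unif n)) :=
        setIntegral_le_integral .of_finite (.of_forall fun _ => abs_nonneg _)
    _ = (∑ i, |f (i, i) - g (i, i)|) / ((n : ℝ) + 1) ^ 2 := by
        rw [integral_unif_prod]
        congr 1
        refine Finset.sum_congr rfl fun i _ => Finset.sum_eq_single i (fun j _ hj => ?_) (by simp)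
        rw [hfg _ hj.symm, sub_self, abs_zero]
    _ ≤ (∑ _i : Fin (n + 1), C) / ((n : ℝ) + 1) ^ 2 := by gcongr; exact hC _
    _ = C / ((n : ℝ) + 1) := by
        simp only [Finset.sum_const, Finset.card_univ, Fintype.card_fin, nsmul_eq_mul]
        push_cast
        field_simp

section LawsOfLargeNumbers

variable {X : Type*} [MeasurableSpace X] {μ : Measure X} [IsProbabilityMeasure μ]

theorem ae_tendsto_integral_unif {f : X → ℝ} (hf : Measurable f) (hfi : Integrable f μ) :
    ∀ᵐ x ∂(Measure.infinitePi fun _ : ℕ => μ),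
      Tendsto (fun n => ∫ i, f (sampleMap x n i) ∂(unif n)) atTop (𝓝 (∫ a, f a ∂μ)) := by
  have hp (i : ℕ) := measurePreserving_eval_infinitePi (fun _ : ℕ => μ) i
  have hident (i : ℕ) : IdentDistrib (fun x : ℕ → X => f (x i)) (fun x : ℕ → X => f (x 0))
      (Measure.infinitePi fun _ => μ) (Measure.infinitePi fun _ => μ) :=
    IdentDistrib.comp (f := fun x : ℕ → X => x i) (g := fun x : ℕ → X => x 0)
      ⟨(hp i).measurable.aemeasurable, (hp 0).measurable.aemeasurable,
        (hp i).map_eq.trans (hp 0).map_eq.symm⟩ hf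
  have hmean : ∫ x : ℕ → X, f (x 0) ∂(Measure.infinitePi fun _ => μ) = ∫ a, f a ∂μ := by
    conv_rhs => rw [← (hp 0).map_eq]
    exact (integral_map (hp 0).measurable.aemeasurable hf.aestronglyMeasurable).symm
  filter_upwards [strong_law_ae_real (fun i (x : ℕ → X) => f (x i))
    ((hp 0).integrable_comp_of_integrable hfi)
    (fun i j hij => (iIndepFun_infinitePi fun _ => hf).indepFun hij) hident] with x hx
  rw [hmean] at hx
  refine ((tendsto_add_atTop_iff_nat 1).2 hx).congr fun n => ?_
  rw [integral_unif, Finset.sum_range, Nat.cast_succ]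
  rfl

variable {D : X × X → ℝ} {C : ℝ}

theorem measure_le_abs_offDiag_sum_le (hD : Measurable D) (hC : ∀ p, |D p| ≤ C)
    (h0 : ∀ y, ∫ z, D (z, y) ∂μ = 0) {s : Finset ℕ} (j : ℕ) {M : ℝ} (hM : s.card * C ^ 2 ≤ M)
    {t : ℝ} (ht : 0 ≤ t) :
    (Measure.infinitePi fun _ : ℕ => μ)
      {x | t ≤ |∑ i ∈ s, if i = j then 0 else D (x i, x j)|} ≤
      ENNReal.ofReal (2 * Real.exp (-t ^ 2 / (2 * M))) := by
  have hC0 : 0 ≤ C := by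
    obtain ⟨x⟩ := μ.nonempty_of_neZero
    exact (abs_nonneg _).trans (hC (x, x))
  have hS : MeasurableSet {x : ℕ → X | t ≤ |∑ i ∈ s, if i = j then 0 else D (x i, x j)|} := by
    refine measurableSet_le measurable_const (Measurable.abs <|
      Finset.measurable_sum _ fun i _ => ?_)
    split_ifs <;> fun_prop
  -- Redrawing `x j` makes it independent of the row, which is then a sum of centered variables.
  have hp := measurePreserving_update (fun _ : ℕ => μ) j
  rw [← hp.measure_preimage hS.nullMeasurableSet, ← Measure.compProd_const]
  refine compProd_apply_le_of_forall_le (hp.measurable hS) fun y => ?_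
  have hrow := measure_le_abs_sum_infinitePi_le (ν := fun _ : ℕ => μ)
    (h := fun i z => if i = j then 0 else D (z, y)) (fun i => by split_ifs <;> fun_prop) (C := C)
    (fun i z => by split_ifs <;> simp [hC, hC0]) (fun i => by split_ifs <;> simp [h0]) hM ht
  refine (measure_mono fun x hx => ?_).trans hrow
  rw [mem_preimage, mem_preimage, mem_ofPred_eq] at hx
  exact hx.trans_eq (congrArg _ (Finset.sum_congr rfl fun i _ => by
    split_ifs with hij
    · rfl
    · rw [Function.update_self, Function.update_of_ne hij]))

theorem ae_tendsto_offDiag_average (hD : Measurable D) (hC : ∀ p, |D p| ≤ C)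
    (h0 : ∀ y, ∫ z, D (z, y) ∂μ = 0) :
    ∀ᵐ x ∂(Measure.infinitePi fun _ : ℕ => μ),
      Tendsto (fun n : ℕ => (∑ j ∈ Finset.range n, ∑ i ∈ Finset.range n,
        if i = j then 0 else D (x i, x j)) / (n : ℝ) ^ 2) atTop (𝓝 0) := by
  obtain ⟨B, hB, hCB⟩ : ∃ B, 0 < B ∧ C ≤ B := ⟨|C| + 1, by positivity, by linarith [le_abs_self C]⟩
  refine ae_tendsto_zero_of_summable
    (b := fun ε n => n * (2 * Real.exp (-(ε ^ 2 / (2 * B ^ 2)) * n))) (fun ε hε => ?_)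
    fun ε hε n => ?_
  · have hr : 0 < ε ^ 2 / (2 * B ^ 2) := by positivity
    refine ((Real.summable_pow_mul_exp_neg_nat_mul 1 hr).mul_left 2).congr fun n => ?_
    ring
  · have hsub : {x : ℕ → X | ε ≤ |(∑ j ∈ Finset.range n, ∑ i ∈ Finset.range n,
        if i = j then 0 else D (x i, x j)) / (n : ℝ) ^ 2|} ⊆ ⋃ j ∈ Finset.range n,
        {x | ε * n ≤ |∑ i ∈ Finset.range n, if i = j then 0 else D (x i, x j)|} := by
      intro x hx
      obtain rfl | hn := eq_or_ne n 0
      · simp [hε.not_ge] at hx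
      rw [mem_ofPred_eq, abs_div, abs_of_nonneg (by positivity : (0 : ℝ) ≤ (n : ℝ) ^ 2)] at hx
      have hrows := (mul_le_of_le_div₀ (by positivity) (by positivity) hx).trans
        (Finset.abs_sum_le_sum_abs _ _)
      obtain ⟨j, hj, hjx⟩ := Finset.exists_le_of_sum_le (f := fun _ => ε * n)
        (Finset.nonempty_range_iff.2 hn) (le_trans (le_of_eq (by simp; ring)) hrows)
      exact mem_biUnion hj hjx
    calc _ ≤ ∑ j ∈ Finset.range n, ENNReal.ofReal
          (2 * Real.exp (-(ε * n) ^ 2 / (2 * (n * B ^ 2)))) :=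
          (measure_mono hsub).trans <| (measure_biUnion_finset_le _ _).trans <|
            Finset.sum_le_sum fun j _ => measure_le_abs_offDiag_sum_le hD
              (fun p => (hC p).trans hCB) h0 j (by simp) (by positivity)
      _ = _ := by
          rw [Finset.sum_const, Finset.card_range, ← ENNReal.ofReal_nsmul, nsmul_eq_mul]
          congr 4
          field_simp

theorem ae_tendsto_integral_unif_prod_of_centered (hD : Measurable D) (hC : ∀ p, |D p| ≤ C)
    (h0 : ∀ y, ∫ z, D (z, y) ∂μ = 0) :
    ∀ᵐ x ∂(Measure.infinitePi fun _ : ℕ => μ),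
      Tendsto (fun n => ∫ p, D (sampleMap x n p.1, sampleMap x n p.2) ∂((unif n).prod (unif n)))
        atTop (𝓝 0) := by
  filter_upwards [ae_tendsto_offDiag_average hD hC h0] with x hx
  set g : ∀ n, Fin (n + 1) × Fin (n + 1) → ℝ := fun n p =>
    if p.1 = p.2 then 0 else D (sampleMap x n p.1, sampleMap x n p.2) with hg
  have hgx : Tendsto (fun n => ∫ p, g n p ∂((unif n).prod (unif n))) atTop (𝓝 0) := by
    refine ((tendsto_add_atTop_iff_nat 1).2 hx).congr fun n => ?_
    rw [integral_unif_prod, Finset.sum_comm]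
    simp only [Finset.sum_range, Nat.cast_succ, hg, Fin.ext_iff, sampleMap]
  have hdiag : Tendsto (fun n : ℕ => C / ((n : ℝ) + 1)) atTop (𝓝 0) := by
    simpa only [mul_one_div, mul_zero] using
      tendsto_one_div_add_atTop_nhds_zero_nat.const_mul C
  have hbound (n : ℕ) (p : Fin (n + 1) × Fin (n + 1)) :
      |D (sampleMap x n p.1, sampleMap x n p.2) - g n p| ≤ C := by
    by_cases hp : p.1 = p.2
    · simpa only [hg, if_pos hp, sub_zero] using hC _
    · simpa only [hg, if_neg hp, sub_self, abs_zero] using (abs_nonneg _).trans (hC (x 0, x 0))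
  have hsub (n : ℕ) : ‖∫ p, D (sampleMap x n p.1, sampleMap x n p.2) ∂((unif n).prod (unif n)) -
      ∫ p, g n p ∂((unif n).prod (unif n))‖ ≤ C / ((n : ℝ) + 1) := by
    simpa only [setIntegral_univ, Real.norm_eq_abs] using
      abs_setIntegral_unif_prod_sub_le (g := g n) (fun p hp => (if_neg hp).symm) (hbound n) univ
  simpa only [sub_add_cancel, add_zero] using (squeeze_zero_norm hsub hdiag).add hgx

theorem ae_tendsto_integral_unif_prod {K : X × X → ℝ} (hK : Measurable K) (hC : ∀ p, |K p| ≤ C) :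
    ∀ᵐ x ∂(Measure.infinitePi fun _ : ℕ => μ),
      Tendsto (fun n => ∫ p, K (sampleMap x n p.1, sampleMap x n p.2) ∂((unif n).prod (unif n)))
        atTop (𝓝 (∫ p, K p ∂(μ.prod μ))) := by
  set c : X → ℝ := fun y => ∫ z, K (z, y) ∂μ with hc
  have hcm : Measurable c := hK.stronglyMeasurable.integral_prod_left'.measurable
  have hcC (y : X) : |c y| ≤ C := by
    simpa using norm_integral_le_of_norm_le_const (μ := μ) (f := fun z => K (z, y))
      (.of_forall fun z => hC (z, y))
  have hDC (p : X × X) : |K p - c p.2| ≤ 2 * C :=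
    (abs_sub _ _).trans (by linarith [hC p, hcC p.2])
  have hD0 (y : X) : ∫ z, (K (z, y) - c y) ∂μ = 0 := by
    have hint : Integrable (fun z => K (z, y)) μ :=
      .of_bound (hK.comp measurable_prodMk_right).aestronglyMeasurable C (.of_forall fun z => hC _)
    rw [integral_sub hint (integrable_const _)]
    simp [hc]
  have hcK : ∫ y, c y ∂μ = ∫ p, K p ∂(μ.prod μ) :=
    (integral_prod_symm K (.of_bound hK.aestronglyMeasurable C (.of_forall hC))).symm
  filter_upwards [ae_tendsto_integral_unif_prod_of_centered (D := fun p => K p - c p.2)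
      (by fun_prop) hDC hD0,
    ae_tendsto_integral_unif hcm (.of_bound hcm.aestronglyMeasurable C (.of_forall hcC))]
    with x hD hcx
  rw [hcK] at hcx
  refine (zero_add (∫ p, K p ∂(μ.prod μ)) ▸ hD.add hcx).congr fun n => ?_
  rw [integral_sub .of_finite .of_finite, integral_fun_snd fun i => c (sampleMap x n i)]
  simp

end LawsOfLargeNumbers

/-- The (unnormalized) Frieze–Kannan cut norm of the top left `n × n` block of an infinite matrix:
the largest absolute value of the sum of the entries of a combinatorial rectangle. -/
noncomputable def cutNorm (n : ℕ) (f : ℕ → ℕ → ℝ) : ℝ :=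
  ⨆ R : Finset (Fin n) × Finset (Fin n), |∑ i ∈ R.1, ∑ j ∈ R.2, f i j|

theorem cutNorm_nonneg (n : ℕ) (f : ℕ → ℕ → ℝ) : 0 ≤ cutNorm n f :=
  Real.iSup_nonneg fun _ => abs_nonneg _

theorem abs_sum_sum_le_cutNorm {n : ℕ} (f : ℕ → ℕ → ℝ) (A B : Finset (Fin n)) :
    |∑ i ∈ A, ∑ j ∈ B, f i j| ≤ cutNorm n f :=
  le_ciSup (f := fun R : Finset (Fin n) × Finset (Fin n) => |∑ i ∈ R.1, ∑ j ∈ R.2, f i j|)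
    (finite_range _).bddAbove (A, B)

theorem exists_cutNorm_eq (n : ℕ) (f : ℕ → ℕ → ℝ) :
    ∃ A B : Finset (Fin n), |∑ i ∈ A, ∑ j ∈ B, f i j| = cutNorm n f :=
  have ⟨R, hR⟩ := exists_eq_ciSup_of_finite
    (f := fun R : Finset (Fin n) × Finset (Fin n) => |∑ i ∈ R.1, ∑ j ∈ R.2, f i j|)
  ⟨R.1, R.2, hR⟩

theorem abs_setIntegral_unif_prod_le_cutNorm {n : ℕ} (A B : Set (Fin (n + 1))) (f : ℕ → ℕ → ℝ) :
    |∫ p in A ×ˢ B, f p.1 p.2 ∂((unif n).prod (unif n))| ≤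
      cutNorm (n + 1) f / ((n : ℝ) + 1) ^ 2 := by
  classical
  have hsum : ∫ p in A ×ˢ B, f p.1 p.2 ∂((unif n).prod (unif n)) =
      (∑ i ∈ A.toFinset, ∑ j ∈ B.toFinset, f i j) / ((n : ℝ) + 1) ^ 2 := by
    rw [← integral_indicator .of_discrete, integral_unif_prod]
    congr 1
    simp only [indicator_apply, mem_prod, ite_and, Finset.sum_ite_irrel, Finset.sum_const_zero,
      ← Finset.sum_filter, filter_mem_univ_eq_toFinset]
  rw [hsum, abs_div, abs_of_pos (by positivity : 0 < ((n : ℝ) + 1) ^ 2)]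
  gcongr
  exact abs_sum_sum_le_cutNorm f _ _

/-- The symmetric matrix with zero diagonal and prescribed entries above the diagonal. -/
noncomputable def symmMatrix (u : Edge → ℝ) (i j : ℕ) : ℝ :=
  if h : i < j then u ⟨(i, j), h⟩ else if h : j < i then u ⟨(j, i), h⟩ else 0

/-- The edges from `A` to `B`, oriented towards the larger index. -/
noncomputable def edges (A B : Finset ℕ) : Finset Edge := (A ×ˢ B).subtype fun e => e.1 < e.2

theorem card_edges_le (A B : Finset ℕ) : (edges A B).card ≤ A.card * B.card := by
  rw [edges, Finset.card_subtype, ← Finset.card_product]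
  exact Finset.card_filter_le _ _

theorem sum_edges (u : Edge → ℝ) (A B : Finset ℕ) :
    ∑ e ∈ edges A B, u e = ∑ i ∈ A, ∑ j ∈ B, if i < j then symmMatrix u i j else 0 := by
  rw [← Finset.sum_product' A B fun i j => if i < j then symmMatrix u i j else 0,
    ← Finset.sum_filter, ← Finset.sum_subtype_eq_sum_filter]
  refine Finset.sum_congr rfl fun e _ => ?_
  rw [symmMatrix, dif_pos e.2]

theorem sum_sum_symmMatrix (u : Edge → ℝ) (A B : Finset ℕ) :
    ∑ i ∈ A, ∑ j ∈ B, symmMatrix u i j = ∑ e ∈ edges A B, u e + ∑ e ∈ edges B A, u e := by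
  simp only [sum_edges, Finset.sum_comm (s := B), ← Finset.sum_add_distrib]
  refine Finset.sum_congr rfl fun i _ => Finset.sum_congr rfl fun j _ => ?_
  rcases lt_trichotomy i j with h | rfl | h
  · simp [h, h.not_gt]
  · simp [symmMatrix]
  · simp [symmMatrix, h, h.not_gt]

theorem exists_le_abs_sum_edges_of_le_cutNorm {n : ℕ} {u : Edge → ℝ} {t : ℝ}
    (h : t ≤ cutNorm n (symmMatrix u)) :
    ∃ A B : Finset (Fin n),
      t / 2 ≤ |∑ e ∈ edges (A.map Fin.valEmbedding) (B.map Fin.valEmbedding), u e| := by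
  obtain ⟨A, B, hAB⟩ := exists_cutNorm_eq n (symmMatrix u)
  have hsum := sum_sum_symmMatrix u (A.map Fin.valEmbedding) (B.map Fin.valEmbedding)
  simp only [Finset.sum_map, Fin.valEmbedding_apply] at hsum
  rw [← hAB, hsum] at h
  obtain h' | h' : t / 2 ≤ |∑ e ∈ edges (A.map Fin.valEmbedding) (B.map Fin.valEmbedding), u e| ∨
      t / 2 ≤ |∑ e ∈ edges (B.map Fin.valEmbedding) (A.map Fin.valEmbedding), u e| := by
    by_contra! hlt
    linarith [h.trans (abs_add_le _ _)]
  exacts [⟨A, B, h'⟩, ⟨B, A, h'⟩]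

theorem summable_four_pow_mul_exp_neg_sq {r : ℝ} (hr : 0 < r) :
    Summable fun n : ℕ => (4 : ℝ) ^ n * Real.exp (-r * (n : ℝ) ^ 2) := by
  refine .of_nonneg_of_le (fun n => by positivity) (fun n => ?_)
    (Real.summable_exp_neg_nat.mul_left (Real.exp ((Real.log 4 + 1) ^ 2 / (4 * r))))
  have hpow : (4 : ℝ) ^ n = Real.exp (n * Real.log 4) := by
    rw [Real.exp_nat_mul, Real.exp_log (by norm_num)]
  rw [hpow, ← Real.exp_add, ← Real.exp_add, Real.exp_le_exp]
  have hsq : (Real.log 4 + 1) ^ 2 / (4 * r) + -(n : ℝ) - (n * Real.log 4 + -r * (n : ℝ) ^ 2) =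
      r * ((n : ℝ) - (Real.log 4 + 1) / (2 * r)) ^ 2 := by
    field_simp
    ring
  linarith [(by positivity : 0 ≤ r * ((n : ℝ) - (Real.log 4 + 1) / (2 * r)) ^ 2)]

theorem measure_le_cutNorm_symmMatrix_le {Ω : Type*} [MeasurableSpace Ω] {F : Edge → Type*}
    [∀ e, MeasurableSpace (F e)] {ρ : Measure Ω} [IsProbabilityMeasure ρ]
    {κ : ∀ e, Kernel Ω (F e)} [∀ e, IsMarkovKernel (κ e)] {h : ∀ e, Ω × F e → ℝ}
    (hm : ∀ e, Measurable (h e)) {C : ℝ} (hC : ∀ e p, |h e p| ≤ C)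
    (h0 : ∀ e a, ∫ b, h e (a, b) ∂(κ e a) = 0) (n : ℕ) {t : ℝ} (ht : 0 ≤ t) :
    (ρ ⊗ₘ infinitePiKernel κ) {s | t ≤ cutNorm n (symmMatrix fun e => h e (s.1, s.2 e))} ≤
      ENNReal.ofReal (4 ^ n * (2 * Real.exp (-(t / 2) ^ 2 / (2 * (n ^ 2 * C ^ 2))))) := by
  set S : Finset (Fin n) × Finset (Fin n) → Set (Ω × ∀ e, F e) := fun R =>
    {s | t / 2 ≤ |∑ e ∈ edges (R.1.map Fin.valEmbedding) (R.2.map Fin.valEmbedding),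
      h e (s.1, s.2 e)|}
  have hS (R : Finset (Fin n) × Finset (Fin n)) : (ρ ⊗ₘ infinitePiKernel κ) (S R) ≤
      ENNReal.ofReal (2 * Real.exp (-(t / 2) ^ 2 / (2 * (n ^ 2 * C ^ 2)))) := by
    refine measure_le_abs_sum_compProd_infinitePiKernel_le hm hC h0 ?_ (by positivity)
    have hcard := (card_edges_le (R.1.map Fin.valEmbedding) (R.2.map Fin.valEmbedding)).trans
      (Nat.mul_le_mul ((Finset.card_map _).trans_le (card_finset_fin_le R.1))
        ((Finset.card_map _).trans_le (card_finset_fin_le R.2)))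
    rw [← sq] at hcard
    gcongr
    exact_mod_cast hcard
  calc _ ≤ (ρ ⊗ₘ infinitePiKernel κ) (⋃ R, S R) := measure_mono fun s hs =>
        have ⟨A, B, hAB⟩ := exists_le_abs_sum_edges_of_le_cutNorm hs
        mem_iUnion.2 ⟨(A, B), hAB⟩
    _ ≤ ∑ R, (ρ ⊗ₘ infinitePiKernel κ) (S R) := measure_iUnion_fintype_le _ _
    _ ≤ ∑ _R : Finset (Fin n) × Finset (Fin n),
          ENNReal.ofReal (2 * Real.exp (-(t / 2) ^ 2 / (2 * (n ^ 2 * C ^ 2)))) :=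
        Finset.sum_le_sum fun R _ => hS R
    _ = _ := by
        rw [Finset.sum_const, ← ENNReal.ofReal_nsmul, nsmul_eq_mul]
        simp [← mul_pow]

theorem ae_tendsto_cutNorm_symmMatrix {Ω : Type*} [MeasurableSpace Ω] {F : Edge → Type*}
    [∀ e, MeasurableSpace (F e)] {ρ : Measure Ω} [IsProbabilityMeasure ρ]
    {κ : ∀ e, Kernel Ω (F e)} [∀ e, IsMarkovKernel (κ e)] {h : ∀ e, Ω × F e → ℝ}
    (hm : ∀ e, Measurable (h e)) {C : ℝ} (hC : ∀ e p, |h e p| ≤ C)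
    (h0 : ∀ e a, ∫ b, h e (a, b) ∂(κ e a) = 0) :
    ∀ᵐ s ∂(ρ ⊗ₘ infinitePiKernel κ),
      Tendsto (fun n : ℕ => cutNorm n (symmMatrix fun e => h e (s.1, s.2 e)) / (n : ℝ) ^ 2)
        atTop (𝓝 0) := by
  obtain ⟨B, hB, hCB⟩ : ∃ B, 0 < B ∧ C ≤ B := ⟨|C| + 1, by positivity, by linarith [le_abs_self C]⟩
  refine ae_tendsto_zero_of_summable
    (b := fun ε n => 4 ^ n * (2 * Real.exp (-(ε ^ 2 / (8 * B ^ 2)) * n ^ 2))) (fun ε hε => ?_)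
    fun ε hε n => ?_
  · refine ((summable_four_pow_mul_exp_neg_sq
      (by positivity : 0 < ε ^ 2 / (8 * B ^ 2))).mul_left 2).congr fun n => ?_
    ring
  · refine (measure_mono fun s hs => ?_).trans <| (measure_le_cutNorm_symmMatrix_le hm
      (fun e p => (hC e p).trans hCB) h0 n (by positivity : 0 ≤ ε * n ^ 2)).trans_eq ?_
    · rw [mem_ofPred_eq, abs_of_nonneg (div_nonneg (cutNorm_nonneg _ _) (by positivity))] at hs
      exact mul_le_of_le_div₀ (cutNorm_nonneg _ _) (by positivity) hs
    · congr 4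
      field_simp
      ring

theorem Nonprincipal.le_atTop (ω : Ultrafilter ℕ) [Nonprincipal ω] : (ω : Filter ℕ) ≤ atTop :=
  atTop_basis.ge_iff.2 fun k _ => Nonprincipal.eventually_ge ω k

theorem abs_setIntegral_sub_le {S : Type*} [MeasurableSpace S] {ν : Measure S} {f g : S → ℝ}
    (hf : Integrable f ν) (hg : Integrable g ν) (B : Set S) :
    |∫ s in B, f s ∂ν - ∫ s in B, g s ∂ν| ≤ ∫ s, |f s - g s| ∂ν := by
  rw [← integral_sub hf.integrableOn hg.integrableOn]
  exact abs_integral_le_integral_abs.trans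
    (setIntegral_le_integral (hf.sub hg).abs (.of_forall fun s => abs_nonneg _))

theorem exists_continuousMap_integral_abs_sub_le {Z : Type*} [MetricSpace Z] [CompactSpace Z]
    [MeasurableSpace Z] [BorelSpace Z] {ρ : Measure Z} [IsFiniteMeasure ρ] {K : Z → ℝ}
    (hK : Integrable K ρ) {ε : ℝ} (hε : 0 < ε) : ∃ H : C(Z, ℝ), ∫ z, |K z - H z| ∂ρ ≤ ε :=
  have ⟨H, hH, _⟩ := hK.exists_boundedContinuous_integral_sub_le hε
  ⟨H.toContinuousMap, hH⟩

section Deterministic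

variable {X : ℕ → Type*} [∀ n, MeasurableSpace (X n)] {ω : Ultrafilter ℕ}
  {P : ∀ n, Measure (X n)}

theorem UltraProd.HasUlim.prodMap {Y : Type*} [TopologicalSpace Y] {f : ∀ n, X n → Y}
    {F : UltraProd ω P → Y} (h : HasUlim f F) :
    HasUlim (fun n (p : X n × X n) => (f n p.1, f n p.2))
      (fun p : UltraSq ω P => (F p.fst, F p.snd)) :=
  (h.comp_map fun _ => Prod.fst).prodMk (h.comp_map fun _ => Prod.snd)

variable [∀ n, IsProbabilityMeasure (P n)] [Nonprincipal ω]

theorem UltraSq.measurePreserving_prodMap {Y : Type*} [MeasurableSpace Y] {μ : Measure Y}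
    [SigmaFinite μ] {F : UltraProd ω P → Y} (hF : MeasurePreserving F volume μ) :
    MeasurePreserving (fun p : UltraSq ω P => (F p.fst, F p.snd)) volume (μ.prod μ) :=
  (hF.prod hF).comp UltraSq.measurePreserving_fst_snd

theorem UltraProd.HasUlim.tendsto_setIntegral_comp {Z : Type*} [MetricSpace Z] [CompactSpace Z]
    [MeasurableSpace Z] [BorelSpace Z] {ρ : Measure Z} {f : ∀ n, X n → Z} {F : UltraProd ω P → Z}
    (h : HasUlim f F) (hf : ∀ n, Measurable (f n)) (hF : MeasurePreserving F volume ρ)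
    {K : Z → ℝ} (hK : Integrable K ρ) (hKf : ∀ n, Integrable (fun a => K (f n a)) (P n))
    (hlim : ∀ ε > 0, ∃ H : C(Z, ℝ), ∫ z, |K z - H z| ∂ρ ≤ ε ∧
      ∀ᶠ n in (ω : Filter ℕ), ∫ a, |K (f n a) - H (f n a)| ∂(P n) ≤ ε)
    {A : ∀ n, Set (X n)} (hA : ∀ n, MeasurableSet (A n)) :
    Tendsto (fun n => ∫ a in A n, K (f n a) ∂(P n)) ω (𝓝 (∫ p in internal ω P A, K (F p))) := by
  refine tendsto_of_forall_exists_approx fun ε hε => ?_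
  obtain ⟨H, hH, hHf⟩ := hlim ε hε
  have hHF : ∫ p, |K (F p) - H (F p)| = ∫ z, |K z - H z| ∂ρ := by
    have hKm : AEStronglyMeasurable K (volume.map F) := hF.map_eq ▸ hK.aestronglyMeasurable
    rw [← hF.map_eq]
    exact (integral_map hF.measurable.aemeasurable
      (hKm.sub H.continuous.aestronglyMeasurable).norm).symm
  refine ⟨_, _, (h.comp_continuous H.continuous).tendsto_setIntegral
    (fun n => H.continuous.measurable.comp (hf n)) (fun n a => H.norm_coe_le_norm _) hA,
    hHf.mono fun n hn => ?_, ?_⟩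
  · exact (abs_setIntegral_sub_le (hKf n) (integrable_comp_continuousMap (hf n) H) _).trans hn
  · rw [dist_comm]
    exact (abs_setIntegral_sub_le (hF.integrable_comp_of_integrable hK)
      (integrable_comp_continuousMap hF.measurable H) _).trans (hHF.trans_le hH)

theorem isSeparableRealization_of_forall_setIntegral_eq {d : ∀ n, X n × X n → I}
    (hd : ∀ n, Measurable (d n)) {Y : Type*} [MeasurableSpace Y] {μ : Measure Y}
    {κ : Kernel (Y × Y) I} [IsMarkovKernel κ] {F : UltraProd ω P → Y}
    (hF : MeasurePreserving F volume μ)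
    (h : ∀ k, ∀ A B : ∀ n, Set (X n), (∀ n, MeasurableSet (A n)) → (∀ n, MeasurableSet (B n)) →
      ∫ p in UltraProd.internal ω (fun n => (P n).prod (P n)) (fun n => A n ×ˢ B n),
        TopologicalSpace.denseSeq C(I, ℝ) k (UltraProd.ulimFun d p) =
      ∫ p : UltraSq ω P in UltraProd.internal ω (fun n => (P n).prod (P n)) (fun n => A n ×ˢ B n),
        ∫ t, TopologicalSpace.denseSeq C(I, ℝ) k t ∂κ (F p.fst, F p.snd)) :
    IsSeparableRealization ω P d μ κ F := by
  have hlaw : volume.map (fun p : UltraSq ω P => ((p.fst, p.snd), UltraProd.ulimFun d p)) =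
      volume.map (fun p : UltraSq ω P => (p.fst, p.snd)) ⊗ₘ
        κ.comap (Prod.map F F) (hF.measurable.prodMap hF.measurable) := by
    refine map_prodMk_eq_compProd_of_setIntegral UltraSq.measurable_fst_snd
      ((UltraProd.hasUlim_ulimFun d).measurable hd) _ fun M N hM hN k => ?_
    obtain ⟨A, hA⟩ := UltraProd.exists_approx hM
    obtain ⟨B, hB⟩ := UltraProd.exists_approx hN
    simp only [← setIntegral_congr_set (UltraSq.internal_prod_ae_eq hA hB)]
    exact h k A B hA.1 hB.1
  have hD : IsUltraDistance ω P d fun p => ⟨κ (F p.fst, F p.snd), inferInstance⟩ := by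
    change IsCondDerivative volume (UltraSq.prodAlgebra ω P) _ _
    rw [UltraSq.prodAlgebra_eq_comap]
    exact isCondDerivative_of_map_prodMk_eq UltraSq.measurable_fst_snd
      ((UltraProd.hasUlim_ulimFun d).measurable hd) hlaw
  exact ⟨hF.measurable, hF.map_eq, ⟨_, hD⟩, fun D hD' =>
    hD.ae_eq UltraSq.prodAlgebra_le hD'⟩

end Deterministic

section Sample

theorem symmMatrix_eq_of_ne {X : Type*} [MeasurableSpace X] {κ : Kernel (X × X) I}
    (hκ : ∀ x y, κ (x, y) = κ (y, x)) (g : C(I, ℝ)) (x : ℕ → X) (l : Edge → I) {i j : ℕ}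
    (hij : i ≠ j) :
    symmMatrix (fun e => g (l e) - ∫ t, g t ∂κ (x e.1.1, x e.1.2)) i j =
      g (sampleMatrix l i j) - ∫ t, g t ∂κ (x i, x j) := by
  rcases hij.lt_or_gt with h | h
  · simp only [symmMatrix, sampleMatrix, dif_pos h]
  · simp only [symmMatrix, sampleMatrix, dif_pos h, dif_neg h.not_gt, hκ (x i)]

variable {X : Type*} [MeasurableSpace X] (μ : Measure X) [IsProbabilityMeasure μ]
  (κ : Kernel (X × X) I) [IsMarkovKernel κ]

/-- The law of independent `μ`-random points `x 0, x 1, …` together with numbers, one for each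
edge `i < j`, that are independent with laws `κ (x i, x j)` when the points are given. For a
quantum metric measure space this is `QMMSpace.sampleLaw`. -/
noncomputable def arrayLaw : Measure ((ℕ → X) × (Edge → I)) :=
  (Measure.infinitePi fun _ : ℕ => μ) ⊗ₘ infinitePiKernel fun e : Edge =>
    κ.comap (fun x : ℕ → X => (x e.1.1, x e.1.2)) (by fun_prop)

theorem measurePreserving_fst_arrayLaw :
    MeasurePreserving Prod.fst (arrayLaw μ κ) (Measure.infinitePi fun _ : ℕ => μ) :=
  ⟨measurable_fst, Measure.fst_compProd _ _⟩

variable {κ}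

theorem ae_tendsto_cutNorm_sub_integral (g : C(I, ℝ)) :
    ∀ᵐ s ∂(arrayLaw μ κ), Tendsto (fun n : ℕ => cutNorm n (symmMatrix fun e =>
      g (s.2 e) - ∫ t, g t ∂κ (s.1 e.1.1, s.1 e.1.2)) / (n : ℝ) ^ 2) atTop (𝓝 0) := by
  refine ae_tendsto_cutNorm_symmMatrix (C := ‖g‖ + ‖g‖)
    (h := fun e (p : (ℕ → X) × I) => g p.2 - ∫ t, g t ∂κ (p.1 e.1.1, p.1 e.1.2))
    (fun e => ?_) (fun e p => ?_) fun e x => ?_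
  · exact (g.continuous.measurable.comp measurable_snd).sub
      ((measurable_integral_kernel κ g).comp (by fun_prop))
  · exact (abs_sub _ _).trans
      (add_le_add (g.norm_coe_le_norm _) (abs_integral_continuousMap_le _ g))
  · rw [Kernel.comap_apply]
    dsimp only
    rw [integral_sub (integrable_continuousMap _ g) (integrable_const _), integral_const,
      probReal_univ, one_smul, sub_self]

theorem ae_tendsto_setIntegral_sub (hκ : ∀ x y, κ (x, y) = κ (y, x)) (g : C(I, ℝ)) :
    ∀ᵐ s ∂(arrayLaw μ κ), ∀ A B : ∀ n, Set (Fin (n + 1)), Tendsto (fun n =>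
      ∫ p in A n ×ˢ B n, (g (sampleDist s.2 n p) -
        ∫ t, g t ∂κ (sampleMap s.1 n p.1, sampleMap s.1 n p.2)) ∂((unif n).prod (unif n)))
      atTop (𝓝 0) := by
  filter_upwards [ae_tendsto_cutNorm_sub_integral μ g] with s hs A B
  set f := symmMatrix fun e => g (s.2 e) - ∫ t, g t ∂κ (s.1 e.1.1, s.1 e.1.2)
  set dev : ∀ n, Fin (n + 1) × Fin (n + 1) → ℝ := fun n p => g (sampleDist s.2 n p) -
    ∫ t, g t ∂κ (sampleMap s.1 n p.1, sampleMap s.1 n p.2)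
  have hdev (n : ℕ) (p : Fin (n + 1) × Fin (n + 1)) (hp : p.1 ≠ p.2) : dev n p = f p.1 p.2 :=
    (symmMatrix_eq_of_ne hκ g s.1 s.2 (Fin.val_ne_of_ne hp)).symm
  have hbound (n : ℕ) (p : Fin (n + 1) × Fin (n + 1)) : |dev n p - f p.1 p.2| ≤ ‖g‖ + ‖g‖ := by
    by_cases hp : p.1 = p.2
    · have hf : f p.1 p.2 = 0 := by simp [f, symmMatrix, hp]
      rw [hf, sub_zero]
      exact (abs_sub _ _).trans
        (add_le_add (g.norm_coe_le_norm _) (abs_integral_continuousMap_le _ g))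
    · rw [hdev n p hp, sub_self, abs_zero]
      positivity
  have hle (n : ℕ) : ‖∫ p in A n ×ˢ B n, dev n p ∂((unif n).prod (unif n))‖ ≤
      (‖g‖ + ‖g‖) / ((n : ℝ) + 1) + cutNorm (n + 1) f / ((n : ℝ) + 1) ^ 2 :=
    (norm_le_norm_sub_add _ (∫ p in A n ×ˢ B n, f p.1 p.2 ∂((unif n).prod (unif n)))).trans
      (add_le_add (abs_setIntegral_unif_prod_sub_le (hdev n) (hbound n) _)
        (abs_setIntegral_unif_prod_le_cutNorm _ _ _))
  have hdiag : Tendsto (fun n : ℕ => (‖g‖ + ‖g‖) / ((n : ℝ) + 1)) atTop (𝓝 0) := by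
    simpa only [mul_one_div, mul_zero] using
      tendsto_one_div_add_atTop_nhds_zero_nat.const_mul (‖g‖ + ‖g‖)
  have hcut : Tendsto (fun n : ℕ => cutNorm (n + 1) f / ((n : ℝ) + 1) ^ 2) atTop (𝓝 0) := by
    simpa only [Nat.cast_succ] using (tendsto_add_atTop_iff_nat 1).2 hs
  exact squeeze_zero_norm hle (by simpa only [add_zero] using hdiag.add hcut)

variable [MetricSpace X] [CompactSpace X] [BorelSpace X]

theorem ae_measurePreserving_ulimFun_sampleMap :
    ∀ᵐ x ∂(Measure.infinitePi fun _ : ℕ => μ), ∀ (ω : Ultrafilter ℕ) [Nonprincipal ω],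
      MeasurePreserving (UltraProd.ulimFun (sampleMap x) : UltraProd ω unif → X) volume μ := by
  filter_upwards [ae_all_iff.2 fun k => ae_tendsto_integral_unif
    (TopologicalSpace.denseSeq C(X, ℝ) k).continuous.measurable
    (integrable_continuousMap μ _)] with x hx ω _
  have hΦ := UltraProd.hasUlim_ulimFun (ω := ω) (P := unif) (sampleMap x)
  have hm := hΦ.measurable fun _ => .of_discrete
  have := Measure.isProbabilityMeasure_map (μ := volume) hm.aemeasurable
  refine ⟨hm, measure_ext_of_denseSeq fun k => ?_⟩
  set g := TopologicalSpace.denseSeq C(X, ℝ) k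
  rw [integral_map hm.aemeasurable g.continuous.aestronglyMeasurable]
  exact tendsto_nhds_unique ((hΦ.comp_continuous g.continuous).tendsto_integral
    (fun _ => .of_discrete) fun n a => g.norm_coe_le_norm _)
    ((hx k).mono_left (Nonprincipal.le_atTop ω))

theorem ae_tendsto_setIntegral_unif_prod {K : X × X → ℝ} (hK : Measurable K) {C : ℝ}
    (hC : ∀ p, |K p| ≤ C) :
    ∀ᵐ x ∂(Measure.infinitePi fun _ : ℕ => μ), ∀ (ω : Ultrafilter ℕ) [Nonprincipal ω],
      ∀ S : ∀ n, Set (Fin (n + 1) × Fin (n + 1)), Tendsto (fun n =>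
        ∫ p in S n, K (sampleMap x n p.1, sampleMap x n p.2) ∂((unif n).prod (unif n))) ω
        (𝓝 (∫ p : UltraSq ω unif in UltraProd.internal ω _ S,
          K (UltraProd.ulimFun (sampleMap x) p.fst, UltraProd.ulimFun (sampleMap x) p.snd))) := by
  have hKi : Integrable K (μ.prod μ) := .of_bound hK.aestronglyMeasurable C (.of_forall hC)
  choose H hH using fun m : ℕ => exists_continuousMap_integral_abs_sub_le hKi
    (Nat.one_div_pos_of_nat (α := ℝ) (n := m) |> half_pos)
  have hlim (m : ℕ) := ae_tendsto_integral_unif_prod (μ := μ) (K := fun p => |K p - H m p|)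
    (C := C + ‖H m‖) (hK.sub (H m).continuous.measurable).abs fun p => by
      rw [abs_abs]
      exact (abs_sub _ _).trans (add_le_add (hC p) ((H m).norm_coe_le_norm p))
  filter_upwards [ae_measurePreserving_ulimFun_sampleMap μ, ae_all_iff.2 hlim] with x hΦ hx ω _ S
  refine (UltraProd.hasUlim_ulimFun (sampleMap x)).prodMap.tendsto_setIntegral_comp
    (fun _ => .of_discrete) (UltraSq.measurePreserving_prodMap (hΦ ω)) hKi (fun _ => .of_finite)
    (fun ε hε => ?_) fun _ => .of_discrete
  obtain ⟨m, hm⟩ := exists_nat_one_div_lt hε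
  have hlt : ∫ p, |K p - H m p| ∂(μ.prod μ) < ε :=
    (hH m).trans_lt ((half_lt_self Nat.one_div_pos_of_nat).trans hm)
  exact ⟨H m, hlt.le, ((hx m).mono_left (Nonprincipal.le_atTop ω)).eventually_le_const hlt⟩

theorem ae_setIntegral_ulimFun_sampleDist_eq (hκ : ∀ x y, κ (x, y) = κ (y, x)) (g : C(I, ℝ)) :
    ∀ᵐ s ∂(arrayLaw μ κ), ∀ (ω : Ultrafilter ℕ) [Nonprincipal ω],
      ∀ A B : ∀ n, Set (Fin (n + 1)),
        ∫ p in UltraProd.internal ω (fun n => (unif n).prod (unif n)) (fun n => A n ×ˢ B n),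
          g (UltraProd.ulimFun (sampleDist s.2) p) =
        ∫ p : UltraSq ω unif in UltraProd.internal ω _ (fun n => A n ×ˢ B n),
          ∫ t, g t ∂κ (UltraProd.ulimFun (sampleMap s.1) p.fst,
            UltraProd.ulimFun (sampleMap s.1) p.snd) := by
  filter_upwards [ae_tendsto_setIntegral_sub μ hκ g,
    (measurePreserving_fst_arrayLaw μ κ).quasiMeasurePreserving.ae
      (ae_tendsto_setIntegral_unif_prod μ (measurable_integral_kernel κ g)
        fun p => abs_integral_continuousMap_le (κ p) g)] with s hdev hmean ω _ A B
  have hd := ((UltraProd.hasUlim_ulimFun (ω := ω) (P := fun n => (unif n).prod (unif n))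
    (sampleDist s.2)).comp_continuous g.continuous).tendsto_setIntegral (fun _ => .of_discrete)
    (C := ‖g‖) (fun n a => g.norm_coe_le_norm _) (A := fun n => A n ×ˢ B n) fun _ => .of_discrete
  have hsub := hd.sub (hmean ω fun n => A n ×ˢ B n)
  refine sub_eq_zero.1 (tendsto_nhds_unique hsub ?_)
  refine ((hdev A B).mono_left (Nonprincipal.le_atTop ω)).congr fun n => ?_
  exact integral_sub .of_finite .of_finite

end Sample

end QMM

theorem mainTheorem5_general {X : Type*} [MetricSpace X] [CompactSpace X] [MeasurableSpace X]
    [BorelSpace X] (μ : Measure X) [IsProbabilityMeasure μ] (κ : Kernel (X × X) I)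
    [IsMarkovKernel κ] (hκ : ∀ x y, κ (x, y) = κ (y, x)) :
    ∀ᵐ s ∂(QMM.arrayLaw μ κ), ∀ (ω : Ultrafilter ℕ) [QMM.Nonprincipal ω],
      QMM.IsSeparableRealization ω QMM.unif (QMM.sampleDist s.2) μ κ
        (QMM.UltraProd.ulimFun (QMM.sampleMap s.1)) := by
  filter_upwards [ae_all_iff.2 fun k => QMM.ae_setIntegral_ulimFun_sampleDist_eq μ hκ
      (TopologicalSpace.denseSeq C(I, ℝ) k),
    (QMM.measurePreserving_fst_arrayLaw μ κ).quasiMeasurePreserving.ae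
      (QMM.ae_measurePreserving_ulimFun_sampleMap μ)] with s hs hΦ ω _
  exact QMM.isSeparableRealization_of_forall_setIntegral_eq (fun _ => .of_discrete) (hΦ ω)
    fun k A B _ _ => hs k ω A B

theorem mainTheorem5 {X : Type*} [MetricSpace X] [CompactSpace X] [MeasurableSpace X]
    [BorelSpace X] (Q : QMM.QMMSpace X) (ω : Ultrafilter ℕ) [QMM.Nonprincipal ω] :
    ∀ᵐ s ∂Q.sampleLaw,
      QMM.IsSeparableRealization ω QMM.unif (QMM.sampleDist s.2) Q.μ Q.dstar
        (QMM.UltraProd.ulimFun (QMM.sampleMap s.1)) :=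
  (mainTheorem5_general Q.μ Q.dstar Q.dstar_symm).mono fun _ hs => hs ω
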